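/- Let $k$ be a field, $S=k[x_1,\dots,x_n]$, and let $I=J_1\cap J_2\cap J_3$, where $J_i=(x_1^{a_{i1}},\dots,x_n^{a_{in}})$ with all $a_{ij}\ge 1$. Assume that $R=S/I$ has type three, i.e. the socle $0:_R\mathfrak m$ of the local Artinian ring $R$ with maximal ideal $\mathfrak m$ has dimension $3$ over the residue field $R/\mathfrak m$. Then $R$ has a canonical module (an injective hull of its residue field), and for every canonical module $\omega$ of $R$ the following conditions are equivalent: (1) $\mathfrak m\subseteq\omega^*(\omega)$, where $\omega^*(\omega)$ is the ideal generated by all $f(x)$ with $x\in\omega$ and $f\in\operatorname{Hom}_R(\omega,R)$; (2) $K:(K:L)\subseteq L:\mathfrak m$ for all ideals $K$ of $R$ generated by a system of parameters and all ideals $L\supseteq K$ (as $R$ is Artinian, only $K=0$ occurs); (3) the inclusion in (2) holds for all ideals $K$ generated by a system of parameters that are not contained in any member of $P$ and all ideals $L\supseteq K$, where $P$ is any given finite (or countable, if $R$ is complete or its residue field is uncountable) set of primes of $R$ different from $\mathfrak m$; (4) $R$ is isomorphic, as a $k$-algebra, to $k[x_1,\dots,x_m]/I'$ for some $m$ and some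 ideal $I'$ in the list below; (5) $R$ is isomorphic, as a ring, to $k[x_1,\dots,x_m]/I'$ for some $m$ and some ideal $I'$ in the list below. The list consists of the following ideals $I'$ of $k[x_1,\dots,x_m]$, where all exponents $a,b,a_i,b_i,c_i$ are positive integers: 1. the Teter ideals $I'=(x_1^{a_1},\dots,x_m^{a_m},\,x_1^{a_1-1}\cdots x_m^{a_m-1})$; 2. $I'=J_1'\cap J_2'\cap J_3'$ with $J_1'=(x_1^a,x_2^b,x_3^{c_3},\dots,x_m^{c_m})$, $J_2'=(x_1^{a+1},x_2,x_3,\dots,x_m)$, $J_3'=(x_1,x_2^{b+1},x_3,\dots,x_m)$, where $m\ge3$ and $c_3,\dots,c_m>1$; 3. $I'=J_1'\cap J_2'\cap J_3'$ with $J_1'=(x_1^a,x_2^{b+1},x_3,\dots,x_m)$, $J_2'=(x_1^{a+1},x_2^b,x_3,\dots,x_m)$, $J_3'=(x_1,x_2,x_3^{c_3},\dots,x_m^{c_m})$, where $m\ge2$; 4. $I'=J_1'\cap J_2'\cap J_3'$ with $J_1'=(x_1^a,x_2,\dots,x_s,x_{s+1}^{b_{s+1}},\dots,x_m^{b_m})$,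 $J_2'=(x_1^{a+1},x_2,\dots,x_m)$, $J_3'=(x_1,x_2^{c_2},\dots,x_s^{c_s},x_{s+1},\dots,x_m)$, for some $1\le s\le m$; 5. $I'=J_1'\cap J_2'\cap J_3'$ with $J_1'=(x_1,\dots,x_t,x_{t+1}^{c_{t+1}},\dots,x_m^{c_m})$, $J_2'=(x_1,\dots,x_s,x_{s+1}^{b_{s+1}},\dots,x_t^{b_t},x_{t+1},\dots,x_m)$, $J_3'=(x_1^{a_1},\dots,x_s^{a_s},x_{s+1},\dots,x_m)$, for some $0\le s\le t\le m$. -/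

import Mathlib

universe u

namespace AlmostGorenstein

/-! ### Local rings: canonical module, trace ideal, type, and the three conditions -/

section LocalRing

variable (R : Type u) [CommRing R] [IsLocalRing R]

/-- `ω` is a canonical module of the Artinian local ring `R`, i.e. an injective hull of the
residue field: `ω` is an injective module which contains a copy of the residue field meeting
every nonzero submodule of `ω` nontrivially. -/
structure IsCanonicalModule (ω : Type u) [AddCommGroup ω] [Module R ω] : Prop where
  injective : Module.Injective R ω
  essential : ∃ ι : IsLocalRing.ResidueField R →ₗ[R] ω, Function.Injective ι ∧
    ∀ N : Submodule R ω, N ⊓ LinearMap.range ι = ⊥ → N = ⊥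

/-- The trace ideal `ω^*(ω)`: the ideal of `R` generated by all `f x` with `x ∈ ω` and
`f : ω → R` an `R`-linear map. -/
def traceIdeal (ω : Type u) [AddCommGroup ω] [Module R ω] : Ideal R :=
  ⨆ f : ω →ₗ[R] R, LinearMap.range f

/-- The Cohen-Macaulay type of an Artinian local ring: the dimension of its socle
`{r | 𝔪 r = 0}` over the residue field `R ⧸ 𝔪`. -/
noncomputable def cmType : ℕ :=
  Module.finrank (R ⧸ IsLocalRing.maximalIdeal R)
    (Submodule.torsionBySet R R (IsLocalRing.maximalIdeal R : Set R))

variable {R} in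
/-- `K` is generated by a system of parameters of `R`: it is generated by `dim R` elements and
its radical is the maximal ideal. -/
def IsParameterIdeal (K : Ideal R) : Prop :=
  ∃ (d : ℕ) (x : Fin d → R), (d : WithBot ℕ∞) = ringKrullDim R ∧
    K = Ideal.span (Set.range x) ∧ K.radical = IsLocalRing.maximalIdeal R

/-- First condition: `𝔪 ⊆ ω^*(ω)`. -/
def Condition1 (ω : Type u) [AddCommGroup ω] [Module R ω] : Prop :=
  IsLocalRing.maximalIdeal R ≤ traceIdeal R ω

/-- Second condition: `K : (K : I) ⊆ I : 𝔪` for all ideals `K` generated by a system of parameters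
and all ideals `I ⊇ K`. -/
def Condition2 : Prop :=
  ∀ K I : Ideal R, IsParameterIdeal K → K ≤ I →
    K.colon ((K.colon (I : Set R) : Ideal R) : Set R) ≤
      I.colon (IsLocalRing.maximalIdeal R : Set R)

variable {R} in
/-- The sets of primes that may be avoided in the third condition: finite sets (or countable ones, if
`R` is complete or its residue field is uncountable) of primes different from the maximal
ideal. -/
def AdmissiblePrimes (P : Set (PrimeSpectrum R)) : Prop :=
  (P.Finite ∨ (P.Countable ∧ (IsAdicComplete (IsLocalRing.maximalIdeal R) R ∨
    Uncountable (IsLocalRing.ResidueField R)))) ∧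
  ∀ p ∈ P, p.asIdeal ≠ IsLocalRing.maximalIdeal R

variable {R} in
/-- Third condition, for a given set `P` of primes: `K : (K : I) ⊆ I : 𝔪` for all ideals `K`
generated by a system of parameters and not contained in any prime of `P`, and all ideals
`I ⊇ K`. -/
def Condition3 (P : Set (PrimeSpectrum R)) : Prop :=
  ∀ K I : Ideal R, IsParameterIdeal K → (∀ p ∈ P, ¬ K ≤ p.asIdeal) → K ≤ I →
    K.colon ((K.colon (I : Set R) : Ideal R) : Set R) ≤
      I.colon (IsLocalRing.maximalIdeal R : Set R)

end LocalRing

/-! ### Monomial ideals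

The variables `x_1, …, x_n` are `X 0, …, X (n - 1)`, indexed by `Fin n`. -/

section Monomial

variable (k : Type u) [Field k] {n : ℕ}

/-- The irreducible monomial ideal `(x_1^{b_1}, …, x_n^{b_n})`, with all exponents positive. -/
noncomputable def powerIdeal (b : Fin n → ℕ+) : Ideal (MvPolynomial (Fin n) k) :=
  Ideal.span (Set.range fun i => (MvPolynomial.X i : MvPolynomial (Fin n) k) ^ (b i : ℕ))

/-- The intersection of three irreducible monomial ideals; row `i` of `a` is the list of exponents
of the `i`-th ideal. -/
noncomputable def tripleIdeal (a : Fin 3 → Fin n → ℕ+) : Ideal (MvPolynomial (Fin n) k) :=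
  powerIdeal k (a 0) ⊓ powerIdeal k (a 1) ⊓ powerIdeal k (a 2)

theorem powerIdeal_le_ker (b : Fin n → ℕ+) :
    powerIdeal k b ≤ RingHom.ker (MvPolynomial.constantCoeff (σ := Fin n) (R := k)) := by
  rw [powerIdeal, Ideal.span_le]
  rintro _ ⟨i, rfl⟩
  simp [RingHom.mem_ker]

theorem ker_le_radical_tripleIdeal (a : Fin 3 → Fin n → ℕ+) :
    RingHom.ker (MvPolynomial.constantCoeff (σ := Fin n) (R := k)) ≤
      (tripleIdeal k a).radical := by
  have hX : ∀ i, (MvPolynomial.X i : MvPolynomial (Fin n) k) ∈ (tripleIdeal k a).radical := by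
    intro i
    have h : ∀ j, (MvPolynomial.X i : MvPolynomial (Fin n) k) ∈ (powerIdeal k (a j)).radical :=
      fun j => ⟨a j i, Ideal.subset_span ⟨i, rfl⟩⟩
    simp only [tripleIdeal, Ideal.radical_inf]
    exact ⟨⟨h 0, h 1⟩, h 2⟩
  have h : ∀ p : MvPolynomial (Fin n) k,
      p - MvPolynomial.C (MvPolynomial.constantCoeff p) ∈ (tripleIdeal k a).radical := by
    intro p
    induction p using MvPolynomial.induction_on with
    | C c => simp
    | add p q hp hq =>
      have := add_mem hp hq
      rwa [sub_add_sub_comm, ← map_add, ← map_add] at this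
    | mul_X p i _ =>
      simpa using Ideal.mul_mem_left _ p (hX i)
  intro p hp
  have := h p
  rwa [RingHom.mem_ker.mp hp, map_zero, sub_zero] at this

instance isLocalRing_quotient (a : Fin 3 → Fin n → ℕ+) :
    IsLocalRing (MvPolynomial (Fin n) k ⧸ tripleIdeal k a) := by
  have hle : tripleIdeal k a ≤
      RingHom.ker (MvPolynomial.constantCoeff (σ := Fin n) (R := k)) :=
    inf_le_right.trans (powerIdeal_le_ker k (a 2))
  have : Nontrivial (MvPolynomial (Fin n) k ⧸ tripleIdeal k a) := by
    refine Ideal.Quotient.nontrivial_iff.mpr fun h => ?_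
    have h1 : (1 : MvPolynomial (Fin n) k) ∈ tripleIdeal k a := h ▸ Submodule.mem_top
    simpa [RingHom.mem_ker] using hle h1
  have hnil : ∀ p : MvPolynomial (Fin n) k, MvPolynomial.constantCoeff p = 0 →
      IsNilpotent (Ideal.Quotient.mk (tripleIdeal k a) p) := by
    intro p hp
    obtain ⟨m, hm⟩ := ker_le_radical_tripleIdeal k a hp
    exact ⟨m, by rw [← map_pow]; exact Ideal.Quotient.eq_zero_iff_mem.mpr hm⟩
  refine IsLocalRing.of_isUnit_or_isUnit_one_sub_self fun r => ?_
  obtain ⟨p, rfl⟩ := Ideal.Quotient.mk_surjective r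
  by_cases hp : MvPolynomial.constantCoeff p = 0
  · exact Or.inr (hnil p hp).isUnit_one_sub
  · left
    have h0 := hnil (p - MvPolynomial.C (MvPolynomial.constantCoeff p)) (by simp)
    have hu : IsUnit (Ideal.Quotient.mk (tripleIdeal k a)
        (MvPolynomial.C (MvPolynomial.constantCoeff p))) :=
      ((isUnit_iff_ne_zero.mpr hp).map MvPolynomial.C).map _
    have := h0.isUnit_add_left_of_commute hu (Commute.all _ _)
    rwa [← map_add, add_sub_cancel] at this

variable {k}

/-- A Teter ideal `(x_1^{a_1}, …, x_n^{a_n}, x_1^{a_1 - 1} ⋯ x_n^{a_n - 1})`. -/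
def IsTeterIdeal (I : Ideal (MvPolynomial (Fin n) k)) : Prop :=
  ∃ a : Fin n → ℕ+,
    I = powerIdeal k a ⊔ Ideal.span {∏ i, MvPolynomial.X i ^ ((a i : ℕ) - 1)}

/-- The ideals `J_1 ∩ J_2 ∩ J_3` with
`J_1 = (x_1^a, x_2^b, x_3^{c_3}, …, x_n^{c_n})`,
`J_2 = (x_1^{a+1}, x_2, x_3, …, x_n)`,
`J_3 = (x_1, x_2^{b+1}, x_3, …, x_n)`,
where `n ≥ 3` and `c_3, …, c_n > 1`. -/
def IsPatternA (I : Ideal (MvPolynomial (Fin n) k)) : Prop :=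
  ∃ (a b : ℕ+) (c : Fin n → ℕ+), 3 ≤ n ∧ (∀ i : Fin n, 2 ≤ (i : ℕ) → 1 < c i) ∧
    I = tripleIdeal k
      ![fun i => if (i : ℕ) = 0 then a else if (i : ℕ) = 1 then b else c i,
        fun i => if (i : ℕ) = 0 then a + 1 else 1,
        fun i => if (i : ℕ) = 1 then b + 1 else 1]

/-- The ideals `J_1 ∩ J_2 ∩ J_3` with
`J_1 = (x_1^a, x_2^{b+1}, x_3, …, x_n)`,
`J_2 = (x_1^{a+1}, x_2^b, x_3, …, x_n)`,
`J_3 = (x_1, x_2, x_3^{c_3}, …, x_n^{c_n})`, where `n ≥ 2`. -/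
def IsPatternB (I : Ideal (MvPolynomial (Fin n) k)) : Prop :=
  ∃ (a b : ℕ+) (c : Fin n → ℕ+), 2 ≤ n ∧
    I = tripleIdeal k
      ![fun i => if (i : ℕ) = 0 then a else if (i : ℕ) = 1 then b + 1 else 1,
        fun i => if (i : ℕ) = 0 then a + 1 else if (i : ℕ) = 1 then b else 1,
        fun i => if (i : ℕ) = 0 then 1 else if (i : ℕ) = 1 then 1 else c i]

/-- The ideals `J_1 ∩ J_2 ∩ J_3` with
`J_1 = (x_1^a, x_2, …, x_s, x_{s+1}^{b_{s+1}}, …, x_n^{b_n})`,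
`J_2 = (x_1^{a+1}, x_2, …, x_n)`,
`J_3 = (x_1, x_2^{c_2}, …, x_s^{c_s}, x_{s+1}, …, x_n)`. -/
def IsPatternC (I : Ideal (MvPolynomial (Fin n) k)) : Prop :=
  ∃ (s : ℕ) (a : ℕ+) (b c : Fin n → ℕ+), 1 ≤ s ∧ s ≤ n ∧
    I = tripleIdeal k
      ![fun i => if (i : ℕ) = 0 then a else if (i : ℕ) < s then 1 else b i,
        fun i => if (i : ℕ) = 0 then a + 1 else 1,
        fun i => if (i : ℕ) = 0 then 1 else if (i : ℕ) < s then c i else 1]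

/-- The ideals `J_1 ∩ J_2 ∩ J_3` with
`J_1 = (x_1, …, x_t, x_{t+1}^{c_{t+1}}, …, x_n^{c_n})`,
`J_2 = (x_1, …, x_s, x_{s+1}^{b_{s+1}}, …, x_t^{b_t}, x_{t+1}, …, x_n)`,
`J_3 = (x_1^{a_1}, …, x_s^{a_s}, x_{s+1}, …, x_n)`. -/
def IsPatternD (I : Ideal (MvPolynomial (Fin n) k)) : Prop :=
  ∃ (s t : ℕ) (a b c : Fin n → ℕ+), s ≤ t ∧ t ≤ n ∧
    I = tripleIdeal k
      ![fun i => if (i : ℕ) < t then 1 else c i,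
        fun i => if (i : ℕ) < s then 1 else if (i : ℕ) < t then b i else 1,
        fun i => if (i : ℕ) < s then a i else 1]

/-- `I` is one of the ideals of the classification. -/
def IsListed (I : Ideal (MvPolynomial (Fin n) k)) : Prop :=
  IsTeterIdeal I ∨ IsPatternA I ∨ IsPatternB I ∨ IsPatternC I ∨ IsPatternD I

end Monomial

end AlmostGorenstein

/-!
The classes of the monomials `x ^ u`, with `u` in the lower set `U` generated by three exponents,
form a basis of `R` over `k`, and `Hom_k(R, k)` is a canonical module.

(1) ⇒ (2): as `ω` is injective, `(0 : (0 : L)) ω ⊆ L ω`, and applying the maps `ω → R` gives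
`(0 : (0 : L)) ω*(ω) ⊆ L`. In an Artinian local ring `0` is the only parameter ideal and `𝔪` the
only prime, so (2) and (3) agree.

(3) ⇒ (4): tested on the ideals `L` generated by a monomial, (3) says that if `x ^ u` kills every
monomial killed by `x ^ v`, then `x ^ v` divides every nonzero `x_l x ^ u`. Hence, among the
monomials `x ^ α_i` spanning the socle, each variable has one such that every other one which it
divides exceeds it by exactly one in that variable and in no other variable. The finitely many
configurations of three exponents allowed by this are those of the list, up to the order of the
variables and up to variables that are zero in `R`.

(5) ⇒ (1): for an exponent `d` the map `φ ↦ ∑ φ(x ^ v) x ^ w`, summed over `v + w = d`, is a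
homomorphism `Hom_k(R, k) → R` as soon as `d` satisfies a combinatorial condition, and for the
ideals of the list suitable `d` yield maps whose images contain the variables. The condition does
not involve the `k`-algebra structure, which may therefore be transported along a ring isomorphism.
-/

namespace AlmostGorenstein

open IsLocalRing

/-! ### Canonical modules and the three conditions -/

section Injective

variable {R : Type u} [CommRing R] {ω : Type u} [AddCommGroup ω] [Module R ω]

theorem mem_smul_top_of_annihilator_le [Module.Injective R ω] {L : Ideal R} (hL : L.FG)
    {y : ω} (hy : ∀ c ∈ L.annihilator, c • y = 0) : y ∈ L • (⊤ : Submodule R ω) := by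
  obtain ⟨s, rfl⟩ := hL
  -- `R ⧸ Ann L` embeds into a power of `R`, so `1 ↦ y` extends to that power.
  let g : R →ₗ[R] s → R := LinearMap.pi fun l => LinearMap.mulRight R (l : R)
  have hker : LinearMap.ker g ≤ LinearMap.ker (LinearMap.toSpanSingleton R ω y) := by
    refine fun c hc => hy c ((Submodule.mem_annihilator_span _ _).mpr fun l => ?_)
    exact congrFun hc l
  obtain ⟨e, he⟩ := Module.Injective.out ((LinearMap.ker g).liftQ g le_rfl)
    (LinearMap.ker_eq_bot.mp (Submodule.ker_liftQ_eq_bot _ _ _ le_rfl))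
    ((LinearMap.ker g).liftQ (LinearMap.toSpanSingleton R ω y) hker)
  have hey : y = e (g 1) := by
    simpa only [Submodule.liftQ_apply, LinearMap.toSpanSingleton_apply, one_smul]
      using (he (Submodule.Quotient.mk 1)).symm
  classical
  have hg : g 1 = ∑ l : s, (l : R) • (Pi.single l 1 : s → R) := by
    ext i
    simp [g, Finset.sum_apply, Pi.single_apply]
  rw [hey, hg, map_sum]
  refine Submodule.sum_mem _ fun l _ => ?_
  rw [map_smul]
  exact Submodule.smul_mem_smul (Ideal.subset_span l.2) trivial

theorem mul_mem_of_mem_traceIdeal [Module.Injective R ω] {L : Ideal R} (hL : L.FG) {r t : R}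
    (hr : r ∈ L.annihilator.annihilator) (ht : t ∈ traceIdeal R ω) : r * t ∈ L := by
  suffices traceIdeal R ω ≤ Submodule.comap (LinearMap.mulLeft R r) L from this ht
  refine iSup_le fun f => ?_
  rintro _ ⟨x, rfl⟩
  have hx : r • x ∈ L • (⊤ : Submodule R ω) := mem_smul_top_of_annihilator_le hL fun c hc => by
    rw [smul_smul, mul_comm, ← smul_eq_mul, Submodule.mem_annihilator.mp hr c hc, zero_smul]
  have hLf : (L • (⊤ : Submodule R ω)).map f ≤ L := by
    rw [Submodule.map_smul'']
    exact Ideal.mul_le_left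
  simpa using hLf (Submodule.mem_map_of_mem hx)

theorem traceIdeal_le_of_equiv {ω' : Type u} [AddCommGroup ω'] [Module R ω'] (e : ω ≃ₗ[R] ω') :
    traceIdeal R ω ≤ traceIdeal R ω' := by
  refine iSup_le fun f => ?_
  rintro _ ⟨x, rfl⟩
  exact Submodule.mem_iSup_of_mem (f ∘ₗ e.symm.toLinearMap) ⟨e x, by simp⟩

variable {M N V : Type u} [AddCommGroup M] [Module R M] [AddCommGroup N] [Module R N]
  [AddCommGroup V] [Module R V]

theorem injective_of_comp_of_essential {ι : V →ₗ[R] M} {g : M →ₗ[R] N}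
    (hess : ∀ K : Submodule R M, K ⊓ LinearMap.range ι = ⊥ → K = ⊥)
    (hg : Function.Injective (g ∘ₗ ι)) : Function.Injective g := by
  refine LinearMap.ker_eq_bot.mp (hess _ (eq_bot_iff.mpr ?_))
  rintro _ ⟨hx, y, rfl⟩
  have hy : y = 0 := hg (by simpa using hx)
  simp [hy]

theorem IsCanonicalModule.nonempty_equiv [IsLocalRing R] (hω : IsCanonicalModule R ω)
    {ω' : Type u} [AddCommGroup ω'] [Module R ω'] (hω' : IsCanonicalModule R ω') :
    Nonempty (ω ≃ₗ[R] ω') := by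
  obtain ⟨ι, hι, hess⟩ := hω.essential
  obtain ⟨ι', hι', hess'⟩ := hω'.essential
  obtain ⟨g, hgι⟩ := hω'.injective.out ι hι ι'
  have hg : Function.Injective g :=
    injective_of_comp_of_essential hess ((LinearMap.ext hgι : g ∘ₗ ι = ι') ▸ hι')
  obtain ⟨p, hpg⟩ := hω.injective.out g hg LinearMap.id
  have hpι : ∀ x, p (ι' x) = ι x := fun x => by rw [← hgι, hpg, LinearMap.id_apply]
  have hp : Function.Injective p :=
    injective_of_comp_of_essential hess' ((LinearMap.ext hpι : p ∘ₗ ι' = ι) ▸ hι)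
  exact ⟨LinearEquiv.ofBijective g ⟨hg, fun y => ⟨p y, hp (hpg (p y))⟩⟩⟩

end Injective

section Nilpotent

theorem exists_ne_zero_forall_smul_eq_zero {R M : Type*} [CommRing R] [AddCommGroup M]
    [Module R M] {I : Ideal R} (hI : IsNilpotent I) {N : Submodule R M} (hN : N ≠ ⊥) :
    ∃ x ∈ N, x ≠ 0 ∧ ∀ r ∈ I, r • x = 0 := by
  obtain ⟨m, hm⟩ := hI
  obtain ⟨j, hj, hj'⟩ := Nat.exists_not_and_succ_of_not_zero_of_exists
    (p := fun j => I ^ j • N = ⊥) (by simpa using hN) ⟨m, by simp [hm]⟩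
  obtain ⟨x, hx, hx0⟩ := Submodule.exists_mem_ne_zero_of_ne_bot hj
  refine ⟨x, Submodule.smul_le_right hx, hx0, fun r hr => ?_⟩
  rw [← Submodule.mem_bot R, ← hj', pow_succ', mul_smul]
  exact Submodule.smul_mem_smul hr hx

variable {R : Type u} [CommRing R] [IsLocalRing R]

theorem isCanonicalModule_of_socle {ω : Type u} [AddCommGroup ω] [Module R ω]
    (hω : Module.Injective R ω) (hnil : IsNilpotent (maximalIdeal R)) {χ : ω} (hχ : χ ≠ 0)
    (hmχ : ∀ r ∈ maximalIdeal R, r • χ = 0)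
    (hsoc : ∀ x : ω, (∀ r ∈ maximalIdeal R, r • x = 0) → x ∈ Submodule.span R {χ}) :
    IsCanonicalModule R ω := by
  have hker : LinearMap.ker (LinearMap.toSpanSingleton R ω χ) = maximalIdeal R :=
    ((maximalIdeal.isMaximal R).eq_of_le
      (fun h => hχ (by simpa using (Ideal.eq_top_iff_one _).mp h)) hmχ).symm
  let ι : ResidueField R →ₗ[R] ω :=
    (maximalIdeal R).liftQ (LinearMap.toSpanSingleton R ω χ) hker.ge
  have hrange : LinearMap.range ι = Submodule.span R {χ} := by
    exact (Submodule.range_liftQ _ _ _).trans (LinearMap.range_toSpanSingleton χ)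
  refine ⟨hω, ι, LinearMap.ker_eq_bot.mp (Submodule.ker_liftQ_eq_bot _ _ _ hker.le),
    fun N hN => ?_⟩
  by_contra hne
  obtain ⟨x, hxN, hx0, hx⟩ := exists_ne_zero_forall_smul_eq_zero hnil hne
  exact hx0 ((Submodule.mem_bot R).mp (hN ▸ ⟨hxN, hrange ▸ hsoc x hx⟩))

theorem eq_maximalIdeal_of_isNilpotent (h : IsNilpotent (maximalIdeal R)) (p : Ideal R)
    [hp : p.IsPrime] : p = maximalIdeal R := by
  obtain ⟨m, hm⟩ := h
  exact le_antisymm (le_maximalIdeal hp.ne_top)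
    (hp.le_of_pow_le (n := m) (hm.trans_le bot_le))

theorem isParameterIdeal_iff_of_isNilpotent (h : IsNilpotent (maximalIdeal R)) {K : Ideal R} :
    IsParameterIdeal K ↔ K = ⊥ := by
  have hdim : ringKrullDim R = 0 := by
    rw [← ringKrullDimZero_iff_ringKrullDim_eq_zero, Ring.krullDimLE_zero_iff]
    intro p hp
    exact eq_maximalIdeal_of_isNilpotent h p ▸ maximalIdeal.isMaximal R
  constructor
  · rintro ⟨d, x, hd, rfl, -⟩
    obtain rfl : d = 0 := by exact_mod_cast hd.trans hdim
    simp
  · rintro rfl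
    refine ⟨0, Fin.elim0, by simp [hdim], by simp, le_antisymm ?_ fun r hr => ?_⟩
    · exact le_maximalIdeal fun h => bot_ne_top (Ideal.radical_eq_top.mp h)
    · obtain ⟨m, hm⟩ := h
      exact ⟨m, hm.le (Ideal.pow_mem_pow hr m)⟩

theorem Condition1.condition2 [IsNoetherianRing R] (h : IsNilpotent (maximalIdeal R))
    {ω : Type u} [AddCommGroup ω] [Module R ω] [Module.Injective R ω] (h1 : Condition1 R ω) :
    Condition2 R := by
  intro K L hK _ r hr
  obtain rfl := (isParameterIdeal_iff_of_isNilpotent h).mp hK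
  rw [Submodule.bot_colon, Submodule.bot_colon] at hr
  exact Submodule.mem_colon.mpr fun t ht =>
    mul_mem_of_mem_traceIdeal (IsNoetherian.noetherian L) hr (h1 ht)

theorem Condition2.condition3 (h2 : Condition2 R) (P : Set (PrimeSpectrum R)) : Condition3 P :=
  fun K L hK _ => h2 K L hK

theorem Condition3.mul_mem (h : IsNilpotent (maximalIdeal R)) {P : Set (PrimeSpectrum R)}
    (hP : ∀ p ∈ P, p.asIdeal ≠ maximalIdeal R) (h3 : Condition3 P) {L : Ideal R} {r t : R}
    (hr : r ∈ L.annihilator.annihilator) (ht : t ∈ maximalIdeal R) : r * t ∈ L := by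
  rw [← Submodule.bot_colon, ← Submodule.bot_colon] at hr
  exact Submodule.mem_colon.mp (h3 ⊥ L ((isParameterIdeal_iff_of_isNilpotent h).mpr rfl)
    (fun p hp => absurd (eq_maximalIdeal_of_isNilpotent h p.asIdeal) (hP p hp)) bot_le hr) t ht

end Nilpotent

/-- The `k`-linear dual of a `k`-algebra `R`, viewed as an `R`-module by `(r • φ) s = φ (r * s)`.
It is an explicit canonical module when `R` is Artinian local with residue field `k`. -/
def DualModule (k R : Type u) [Field k] [CommRing R] [Algebra k R] : Type u := R →ₗ[k] k

namespace DualModule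

variable {k R : Type u} [Field k] [CommRing R] [Algebra k R]

instance : AddCommGroup (DualModule k R) := inferInstanceAs (AddCommGroup (R →ₗ[k] k))

instance : FunLike (DualModule k R) R k := inferInstanceAs (FunLike (R →ₗ[k] k) R k)

instance : LinearMapClass (DualModule k R) k R k :=
  inferInstanceAs (LinearMapClass (R →ₗ[k] k) k R k)

instance : SMul R (DualModule k R) := ⟨fun r φ => LinearMap.comp φ (LinearMap.mulLeft k r)⟩

theorem smul_apply (r s : R) (φ : DualModule k R) : (r • φ) s = φ (r * s) := rfl

theorem add_apply (φ ψ : DualModule k R) (s : R) : (φ + ψ) s = φ s + ψ s := rfl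

theorem zero_apply (s : R) : (0 : DualModule k R) s = 0 := rfl

theorem ext {φ ψ : DualModule k R} (h : ∀ s, φ s = ψ s) : φ = ψ := DFunLike.ext _ _ h

instance : Module R (DualModule k R) where
  one_smul φ := ext fun s => by simp [smul_apply]
  mul_smul r s φ := ext fun t => by simp only [smul_apply, mul_left_comm, mul_assoc]
  smul_zero r := ext fun _ => by simp [smul_apply, zero_apply]
  smul_add r φ ψ := ext fun s => by simp [smul_apply, add_apply]
  add_smul r s φ := ext fun t => by simp [smul_apply, add_apply, add_mul]
  zero_smul φ := ext fun s => by simp [smul_apply, zero_apply]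

theorem injective : Module.Injective R (DualModule k R) := by
  refine Module.Baer.injective fun I g => ?_
  let ev : I →ₗ[k] k :=
    { toFun := fun x => g x 1
      map_add' := fun x y => by rw [map_add, add_apply]
      map_smul' := fun c x => by
        rw [← algebraMap_smul R c x, map_smul, smul_apply, ← Algebra.smul_def, map_smul,
          RingHom.id_apply] }
  obtain ⟨p, hp⟩ := LinearMap.exists_leftInverse_of_injective (I.subtype.restrictScalars k)
    (LinearMap.ker_eq_bot.mpr I.injective_subtype)
  let φ : DualModule k R := ev ∘ₗ p
  refine ⟨LinearMap.toSpanSingleton R (DualModule k R) φ, fun x hx => ext fun s => ?_⟩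
  calc φ (x * s) = φ (s * x) := by rw [mul_comm]
    _ = g (s • ⟨x, hx⟩) 1 := congrArg ev (LinearMap.congr_fun hp (s • ⟨x, hx⟩))
    _ = g ⟨x, hx⟩ s := by rw [map_smul, smul_apply, mul_one]

theorem isCanonicalModule [IsLocalRing R]
    (hk : ∀ r : R, ∃ c : k, r - algebraMap k R c ∈ maximalIdeal R)
    (hnil : IsNilpotent (maximalIdeal R)) : IsCanonicalModule R (DualModule k R) := by
  have : Nontrivial (DualModule k R) := inferInstanceAs (Nontrivial (R →ₗ[k] k))
  obtain ⟨χ, -, hχ, hmχ⟩ := exists_ne_zero_forall_smul_eq_zero hnil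
    (N := (⊤ : Submodule R (DualModule k R))) top_ne_bot
  have apply_eq {φ : DualModule k R} (hφ : ∀ r ∈ maximalIdeal R, r • φ = 0) {s : R} {c : k}
      (hs : s - algebraMap k R c ∈ maximalIdeal R) : φ s = c * φ 1 := by
    have h0 : φ (s - algebraMap k R c) = 0 := by
      simpa [smul_apply, zero_apply] using DFunLike.congr_fun (hφ _ hs) 1
    rwa [map_sub, Algebra.algebraMap_eq_smul_one, map_smul, sub_eq_zero] at h0
  have hχ1 : χ 1 ≠ 0 := fun h => hχ <| ext fun s => by
    obtain ⟨c, hc⟩ := hk s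
    rw [apply_eq hmχ hc, h, mul_zero, zero_apply]
  refine isCanonicalModule_of_socle injective hnil hχ hmχ fun φ hφ => ?_
  refine Submodule.mem_span_singleton.mpr ⟨algebraMap k R (φ 1 / χ 1), ext fun s => ?_⟩
  obtain ⟨c, hc⟩ := hk s
  rw [smul_apply, ← Algebra.smul_def, map_smul, apply_eq hmχ hc, apply_eq hφ hc, smul_eq_mul]
  field_simp

end DualModule

/-! ### Quotients by monomial ideals -/

open MvPolynomial Finset.HasAntidiagonal

/-- `π` presents `R` as the quotient of a polynomial ring by the monomial ideal of finite
colength whose standard monomials are those with exponent in the lower set `U`. -/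
structure IsMonomialQuotient {k R σ : Type*} [Field k] [CommRing R] [Algebra k R]
    (π : MvPolynomial σ k →ₐ[k] R) (U : LowerSet (σ →₀ ℕ)) : Prop where
  surjective : Function.Surjective π
  eq_zero_iff : ∀ p, π p = 0 ↔ ∀ u ∈ U, coeff u p = 0
  bddAbove : BddAbove (U : Set (σ →₀ ℕ))

section LinearDegrees

variable {σ : Type*} (U : LowerSet (σ →₀ ℕ))

/-- A condition on `d` under which `φ ↦ ∑ φ(x ^ v) x ^ w`, summed over `v + w = d`, commutes with
multiplication by the variables: every product of two standard monomials of degree `d + e_t` is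
divisible by `x_t` in both factors. -/
def IsLinearDegree (d : σ →₀ ℕ) : Prop :=
  ∀ (t : σ) (v w : σ →₀ ℕ), v + w = d + Finsupp.single t 1 → w t = 0 → v ∈ U → w ∉ U

/-- Every standard variable `x_l` is hit by the map attached to some linear degree `u + e_l`,
as the image of the functional dual to the standard monomial `x ^ u`. -/
def HasLinearDegrees : Prop :=
  ∀ l : σ, Finsupp.single l 1 ∈ U → ∃ u ∈ U, IsLinearDegree U (u + Finsupp.single l 1)

/-- The combinatorial content of `0 : (0 : L) ⊆ L : 𝔪` for the ideals `L` generated by a standard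
monomial `x ^ v`: the hypothesis on `w` says that `x ^ u` lies in `0 : (0 : x ^ v)`. -/
def MonomialColonCondition : Prop :=
  ∀ (u v : σ →₀ ℕ) (l : σ), (∀ w, w + u ∈ U → w + v ∈ U) → u + Finsupp.single l 1 ∈ U →
    v ≤ u + Finsupp.single l 1

end LinearDegrees

section Antidiagonal

variable {σ M : Type*} [DecidableEq σ] [AddCommMonoid M]

theorem sum_antidiagonal_add_single_fst {d : σ →₀ ℕ} {t : σ}
    {g : (σ →₀ ℕ) × (σ →₀ ℕ) → M}
    (hg : ∀ v w, v + w = d + Finsupp.single t 1 → v t = 0 → g (v, w) = 0) :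
    ∑ x ∈ antidiagonal d, g (x.1 + Finsupp.single t 1, x.2) =
      ∑ x ∈ antidiagonal (d + Finsupp.single t 1), g x := by
  refine Finset.sum_of_injOn (fun x => (x.1 + Finsupp.single t 1, x.2)) ?_ ?_ ?_ fun _ _ => rfl
  · rintro ⟨v, w⟩ _ ⟨v', w'⟩ _ h
    simpa using h
  · rintro ⟨v, w⟩ hx
    simp only [Finset.mem_coe, mem_antidiagonal] at hx ⊢
    rw [← hx, add_right_comm]
  · rintro ⟨v, w⟩ hx hx'
    rw [mem_antidiagonal] at hx
    refine hg v w hx ?_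
    by_contra hv
    have hv' : v - Finsupp.single t 1 + Finsupp.single t 1 = v :=
      tsub_add_cancel_of_le (Finsupp.single_le_iff.mpr (Nat.one_le_iff_ne_zero.mpr hv))
    rw [← hv', add_right_comm] at hx
    exact hx' ⟨(v - Finsupp.single t 1, w),
      Finset.mem_coe.mpr (mem_antidiagonal.mpr (add_right_cancel hx)), Prod.ext hv' rfl⟩

theorem sum_antidiagonal_comp_swap (d : σ →₀ ℕ) (g : (σ →₀ ℕ) × (σ →₀ ℕ) → M) :
    ∑ x ∈ antidiagonal d, g x.swap = ∑ x ∈ antidiagonal d, g x :=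
  Finset.sum_equiv (Equiv.prodComm _ _) (fun _ => swap_mem_antidiagonal.symm) fun _ _ => rfl

theorem sum_antidiagonal_add_single_snd {d : σ →₀ ℕ} {t : σ}
    {g : (σ →₀ ℕ) × (σ →₀ ℕ) → M}
    (hg : ∀ v w, v + w = d + Finsupp.single t 1 → w t = 0 → g (v, w) = 0) :
    ∑ x ∈ antidiagonal d, g (x.1, x.2 + Finsupp.single t 1) =
      ∑ x ∈ antidiagonal (d + Finsupp.single t 1), g x := by
  rw [← sum_antidiagonal_comp_swap, ← sum_antidiagonal_comp_swap _ g]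
  exact sum_antidiagonal_add_single_fst (g := g ∘ Prod.swap) fun v w hvw =>
    hg w v (by rw [add_comm, hvw])

end Antidiagonal

theorem map_X_mul_map_monomial {k R σ : Type*} [CommSemiring k] [CommSemiring R] [Algebra k R]
    (π : MvPolynomial σ k →ₐ[k] R) (t : σ) (u : σ →₀ ℕ) :
    π (X t) * π (monomial u 1) = π (monomial (u + Finsupp.single t 1) 1) := by
  rw [← map_mul, mul_comm, X, monomial_mul, one_mul]

/-- The map `φ ↦ ∑ φ(x ^ v) x ^ w`, summed over `v + w = d`, from the dual of a monomial quotient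
to the quotient. It sends the functional dual to `x ^ u` to `x ^ (d - u)`. -/
noncomputable def homogMap {k R : Type u} {σ : Type*} [Field k] [CommRing R] [Algebra k R]
    [DecidableEq σ] (π : MvPolynomial σ k →ₐ[k] R) (d : σ →₀ ℕ) (φ : DualModule k R) : R :=
  ∑ x ∈ antidiagonal d, φ (π (monomial x.1 1)) • π (monomial x.2 1)

namespace IsMonomialQuotient

section Basic

variable {k R σ : Type*} [Field k] [CommRing R] [Algebra k R]
  {π : MvPolynomial σ k →ₐ[k] R} {U : LowerSet (σ →₀ ℕ)}

theorem monomial_eq_zero_iff (h : IsMonomialQuotient π U) (u : σ →₀ ℕ) :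
    π (monomial u 1) = 0 ↔ u ∉ U := by
  classical
  rw [h.eq_zero_iff]
  refine ⟨fun h' hu => by simpa using h' u hu, fun hu v hv => ?_⟩
  rw [coeff_monomial, if_neg]
  rintro rfl
  exact hu hv

theorem isNilpotent_X (h : IsMonomialQuotient π U) (l : σ) : IsNilpotent (π (X l)) := by
  obtain ⟨d, hd⟩ := h.bddAbove
  refine ⟨d l + 1, ?_⟩
  rw [← map_pow, X_pow_eq_monomial, h.monomial_eq_zero_iff]
  intro hl
  simpa using hd hl l

theorem exists_sub_mem_span (h : IsMonomialQuotient π U) (r : R) :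
    ∃ c : k, r - algebraMap k R c ∈ Ideal.span (Set.range fun l => π (X l)) := by
  obtain ⟨p, rfl⟩ := h.surjective r
  refine ⟨constantCoeff p, ?_⟩
  induction p using MvPolynomial.induction_on with
  | C c => simp [← algebraMap_eq]
  | add p q hp hq =>
    rw [map_add, map_add, map_add, add_sub_add_comm]
    exact add_mem hp hq
  | mul_X p l _ =>
    simpa using Ideal.mul_mem_left _ (π p) (Ideal.subset_span (Set.mem_range_self l) :
      π (X l) ∈ Ideal.span (Set.range fun l => π (X l)))

theorem monomial_mem_annihilator_annihilator (h : IsMonomialQuotient π U) {u v : σ →₀ ℕ}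
    (huv : ∀ w, w + u ∈ U → w + v ∈ U) :
    π (monomial u 1) ∈ (Ideal.span {π (monomial v 1)}).annihilator.annihilator := by
  refine Submodule.mem_annihilator.mpr fun r hr => ?_
  obtain ⟨p, rfl⟩ := h.surjective r
  rw [Submodule.mem_annihilator_span_singleton, smul_eq_mul, ← map_mul, h.eq_zero_iff] at hr
  rw [smul_eq_mul, mul_comm, ← map_mul, h.eq_zero_iff]
  intro z hz
  rw [coeff_mul_monomial']
  split_ifs with hle
  · simpa using hr (z - u + v) (huv _ (by rwa [tsub_add_cancel_of_le hle]))
  · rfl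

theorem le_of_monomial_mem_span (h : IsMonomialQuotient π U) {u v : σ →₀ ℕ} (hu : u ∈ U)
    (huv : π (monomial u 1) ∈ Ideal.span {π (monomial v 1)}) : v ≤ u := by
  obtain ⟨c, hc⟩ := Ideal.mem_span_singleton'.mp huv
  obtain ⟨p, rfl⟩ := h.surjective c
  rw [← map_mul, ← sub_eq_zero, ← map_sub, h.eq_zero_iff] at hc
  classical
  by_contra hvu
  simpa [coeff_monomial, coeff_mul_monomial', hvu] using hc u hu

theorem isNoetherianRing [Finite σ] (h : IsMonomialQuotient π U) : IsNoetherianRing R :=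
  isNoetherianRing_of_surjective _ _ π.toRingHom h.surjective

section LocalRing

variable [IsLocalRing R]

theorem maximalIdeal_eq (h : IsMonomialQuotient π U) :
    maximalIdeal R = Ideal.span (Set.range fun l => π (X l)) := by
  have hle : Ideal.span (Set.range fun l => π (X l)) ≤ maximalIdeal R := by
    rw [Ideal.span_le]
    rintro _ ⟨l, rfl⟩
    exact (h.isNilpotent_X l).not_isUnit
  refine le_antisymm (fun r hr => ?_) hle
  obtain ⟨c, hc⟩ := h.exists_sub_mem_span r
  obtain rfl | hc0 := eq_or_ne c 0
  · simpa using hc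
  · have hcm : algebraMap k R c ∈ maximalIdeal R := by
      simpa using sub_mem hr (hle hc)
    exact absurd (hc0.isUnit.map (algebraMap k R)) hcm

theorem X_mem_maximalIdeal (h : IsMonomialQuotient π U) (l : σ) : π (X l) ∈ maximalIdeal R :=
  (h.isNilpotent_X l).not_isUnit

theorem monomialColonCondition (h : IsMonomialQuotient π U)
    (hR : ∀ (L : Ideal R) (r t : R), r ∈ L.annihilator.annihilator → t ∈ maximalIdeal R →
      r * t ∈ L) : MonomialColonCondition U := by
  refine fun u v l huv hu => h.le_of_monomial_mem_span hu ?_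
  rw [← map_X_mul_map_monomial, mul_comm]
  exact hR _ _ _ (h.monomial_mem_annihilator_annihilator huv) (h.X_mem_maximalIdeal l)

variable [Finite σ]

theorem isNilpotent_maximalIdeal (h : IsMonomialQuotient π U) : IsNilpotent (maximalIdeal R) := by
  have := h.isNoetherianRing
  rw [h.maximalIdeal_eq, Ideal.FG.isNilpotent_iff_le_nilradical (IsNoetherian.noetherian _),
    Ideal.span_le]
  rintro _ ⟨l, rfl⟩
  exact h.isNilpotent_X l

end LocalRing

end Basic

section Dual

variable {k R : Type u} {σ : Type*} [Field k] [CommRing R] [Algebra k R]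
  {π : MvPolynomial σ k →ₐ[k] R} {U : LowerSet (σ →₀ ℕ)}

theorem exists_dual (h : IsMonomialQuotient π U) {u : σ →₀ ℕ} (hu : u ∈ U) :
    ∃ φ : DualModule k R, ∀ p, φ (π p) = coeff u p := by
  obtain ⟨s, hs⟩ := π.toLinearMap.exists_rightInverse_of_surjective
    (LinearMap.range_eq_top.mpr h.surjective)
  refine ⟨lcoeff k u ∘ₗ s, fun p => ?_⟩
  change coeff u (s (π p)) = coeff u p
  have hsp : π (s (π p) - p) = 0 := by
    rw [map_sub, sub_eq_zero]
    exact LinearMap.congr_fun hs (π p)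
  rw [← sub_eq_zero, ← coeff_sub]
  exact (h.eq_zero_iff _).mp hsp u hu

theorem isCanonicalModule [IsLocalRing R] [Finite σ] (h : IsMonomialQuotient π U) :
    IsCanonicalModule R (DualModule k R) :=
  DualModule.isCanonicalModule (h.maximalIdeal_eq ▸ h.exists_sub_mem_span)
    h.isNilpotent_maximalIdeal

section HomogMap

variable [DecidableEq σ]

theorem homogMap_X_smul (h : IsMonomialQuotient π U) {d : σ →₀ ℕ} (hd : IsLinearDegree U d)
    (t : σ) (φ : DualModule k R) : homogMap π d (π (X t) • φ) = π (X t) * homogMap π d φ := by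
  let g : (σ →₀ ℕ) × (σ →₀ ℕ) → R := fun x => φ (π (monomial x.1 1)) • π (monomial x.2 1)
  have g_eq_zero {v w : σ →₀ ℕ} (hvw : v ∉ U ∨ w ∉ U) : g (v, w) = 0 := by
    rcases hvw with hv | hw
    · simp [g, (h.monomial_eq_zero_iff v).mpr hv]
    · simp [g, (h.monomial_eq_zero_iff w).mpr hw]
  have hfst : ∀ v w, v + w = d + Finsupp.single t 1 → v t = 0 → g (v, w) = 0 :=
    fun v w hvw hv => g_eq_zero <| or_iff_not_imp_right.mpr fun hw =>
      hd t w v (by rw [add_comm, hvw]) hv (not_not.mp hw)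
  have hsnd : ∀ v w, v + w = d + Finsupp.single t 1 → w t = 0 → g (v, w) = 0 :=
    fun v w hvw hw => g_eq_zero <| or_iff_not_imp_left.mpr fun hv =>
      hd t v w hvw hw (not_not.mp hv)
  calc homogMap π d (π (X t) • φ)
      = ∑ x ∈ antidiagonal d, g (x.1 + Finsupp.single t 1, x.2) := by
        simp only [homogMap, g, DualModule.smul_apply, map_X_mul_map_monomial]
    _ = ∑ x ∈ antidiagonal d, g (x.1, x.2 + Finsupp.single t 1) := by
        rw [sum_antidiagonal_add_single_fst hfst, sum_antidiagonal_add_single_snd hsnd]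
    _ = π (X t) * homogMap π d φ := by
        simp only [homogMap, g, Finset.mul_sum, mul_smul_comm, map_X_mul_map_monomial]

theorem homogMap_add (d : σ →₀ ℕ) (φ ψ : DualModule k R) :
    homogMap π d (φ + ψ) = homogMap π d φ + homogMap π d ψ := by
  simp only [homogMap, DualModule.add_apply, add_smul, Finset.sum_add_distrib]

theorem homogMap_smul (h : IsMonomialQuotient π U) {d : σ →₀ ℕ} (hd : IsLinearDegree U d)
    (r : R) (φ : DualModule k R) : homogMap π d (r • φ) = r * homogMap π d φ := by
  obtain ⟨p, rfl⟩ := h.surjective r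
  induction p using MvPolynomial.induction_on generalizing φ with
  | C c =>
    simp only [← algebraMap_eq, AlgHom.commutes, homogMap, DualModule.smul_apply,
      ← Algebra.smul_def, map_smul, smul_assoc, Finset.smul_sum]
  | add p q hp hq => rw [map_add, add_smul, homogMap_add, hp, hq, add_mul]
  | mul_X p t hp => rw [map_mul, mul_smul, hp, h.homogMap_X_smul hd, mul_assoc]

theorem homogMap_add_of_dual {u w : σ →₀ ℕ} {φ : DualModule k R}
    (hφ : ∀ p, φ (π p) = coeff u p) : homogMap π (u + w) φ = π (monomial w 1) := by
  rw [homogMap, Finset.sum_eq_single (u, w)]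
  · simp [hφ]
  · rintro ⟨v, w'⟩ hx hne
    have hvu : v ≠ u := by
      rintro rfl
      rw [mem_antidiagonal] at hx
      exact hne (Prod.ext rfl (add_left_cancel hx))
    simp [hφ, coeff_monomial, hvu]
  · intro hx
    simp [mem_antidiagonal] at hx

end HomogMap

theorem X_mem_traceIdeal (h : IsMonomialQuotient π U) {u : σ →₀ ℕ} (hu : u ∈ U) {l : σ}
    (hd : IsLinearDegree U (u + Finsupp.single l 1)) :
    π (X l) ∈ traceIdeal R (DualModule k R) := by
  classical
  obtain ⟨φ, hφ⟩ := h.exists_dual hu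
  let f : DualModule k R →ₗ[R] R :=
    { toFun := homogMap π (u + Finsupp.single l 1)
      map_add' := homogMap_add _
      map_smul' := h.homogMap_smul hd }
  exact Submodule.mem_iSup_of_mem f ⟨φ, homogMap_add_of_dual hφ⟩

theorem condition1 [IsLocalRing R] [Finite σ] (h : IsMonomialQuotient π U)
    (hU : HasLinearDegrees U) {ω : Type u} [AddCommGroup ω] [Module R ω]
    (hω : IsCanonicalModule R ω) : Condition1 R ω := by
  obtain ⟨e⟩ := h.isCanonicalModule.nonempty_equiv hω
  refine le_trans ?_ (traceIdeal_le_of_equiv e)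
  rw [h.maximalIdeal_eq, Ideal.span_le]
  rintro _ ⟨l, rfl⟩
  by_cases hl : Finsupp.single l 1 ∈ U
  · obtain ⟨u, hu, hd⟩ := hU l hl
    exact h.X_mem_traceIdeal hu hd
  · have hX : π (X l) = 0 := (h.monomial_eq_zero_iff _).mpr hl
    simp [hX]

end Dual

section Equiv

variable {k R R' σ τ : Type*} [Field k] [CommRing R] [Algebra k R] [CommRing R'] [Algebra k R']
  {π : MvPolynomial σ k →ₐ[k] R} {U : LowerSet (σ →₀ ℕ)}

theorem comp_algEquiv (h : IsMonomialQuotient π U) (e : R ≃ₐ[k] R') :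
    IsMonomialQuotient (e.toAlgHom.comp π) U where
  surjective := e.surjective.comp h.surjective
  eq_zero_iff p := (map_eq_zero_iff e e.injective).trans (h.eq_zero_iff p)
  bddAbove := h.bddAbove

theorem comp_rename (h : IsMonomialQuotient π U) {φ : τ → σ} (hφ : Function.Injective φ)
    {V : LowerSet (τ →₀ ℕ)} (hUV : (U : Set (σ →₀ ℕ)) = Finsupp.mapDomain φ '' V) :
    IsMonomialQuotient (π.comp (rename φ)) V where
  surjective r := by
    have hX : ∀ l ∉ Set.range φ, π (X l) = 0 := by
      refine fun l hl => (h.monomial_eq_zero_iff _).mpr fun hlU => ?_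
      rw [← SetLike.mem_coe, hUV] at hlU
      obtain ⟨v, -, hv⟩ := hlU
      have hvl := Finsupp.mapDomain_of_notMem_range v l hl
      simp [hv] at hvl
    have hkill : (π.comp (rename φ)).comp (killCompl hφ) = π := by
      refine algHom_ext fun l => ?_
      by_cases hl : l ∈ Set.range φ
      · obtain ⟨j, rfl⟩ := hl
        simp [killCompl]
      · simp [killCompl, hl, hX l hl]
    obtain ⟨p, rfl⟩ := h.surjective r
    exact ⟨killCompl hφ p, AlgHom.congr_fun hkill p⟩
  eq_zero_iff p := by
    rw [AlgHom.comp_apply, h.eq_zero_iff]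
    change (∀ u ∈ (U : Set (σ →₀ ℕ)), _) ↔ _
    simp only [hUV, Set.forall_mem_image, coeff_rename_mapDomain φ hφ, SetLike.mem_coe]
  bddAbove := by
    obtain ⟨d, hd⟩ := h.bddAbove
    refine ⟨d.comapDomain φ hφ.injOn, fun v hv l => ?_⟩
    have hvd := hd (hUV ▸ Set.mem_image_of_mem _ hv) (φ l)
    rwa [Finsupp.mapDomain_apply hφ] at hvd

theorem nonempty_algEquiv (h : IsMonomialQuotient π U) {π' : MvPolynomial σ k →ₐ[k] R'}
    (h' : IsMonomialQuotient π' U) : Nonempty (R ≃ₐ[k] R') := by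
  have hker : RingHom.ker π = RingHom.ker π' := by
    ext p
    rw [RingHom.mem_ker, RingHom.mem_ker, h.eq_zero_iff, h'.eq_zero_iff]
  exact ⟨(Ideal.quotientKerAlgEquivOfSurjective h.surjective).symm.trans
    ((Ideal.quotientEquivAlgOfEq k hker).trans
      (Ideal.quotientKerAlgEquivOfSurjective h'.surjective))⟩

end Equiv

theorem condition1_of_ringEquiv {k R S : Type u} {σ : Type*} [Finite σ] [Field k] [CommRing R]
    [CommRing S] [IsLocalRing R] [Algebra k S] {π : MvPolynomial σ k →ₐ[k] S}
    {U : LowerSet (σ →₀ ℕ)} (h : IsMonomialQuotient π U) (hU : HasLinearDegrees U)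
    (e : R ≃+* S) {ω : Type u} [AddCommGroup ω] [Module R ω] (hω : IsCanonicalModule R ω) :
    Condition1 R ω := by
  let _ : Algebra k R := ((e.symm : S →+* R).comp (algebraMap k S)).toAlgebra
  have eₐ : S ≃ₐ[k] R := AlgEquiv.ofRingEquiv (f := e.symm) fun _ => rfl
  exact (h.comp_algEquiv eₐ).condition1 hU hω

end IsMonomialQuotient

section MapDomain

variable {σ τ : Type*} {φ : τ → σ} (hφ : Function.Injective φ)
include hφ

theorem mapDomain_eq_of_forall {v : τ →₀ ℕ} {u : σ →₀ ℕ} (huv : ∀ x, u (φ x) = v x)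
    (hu : ∀ l ∉ Set.range φ, u l = 0) : Finsupp.mapDomain φ v = u := by
  ext l
  by_cases hl : l ∈ Set.range φ
  · obtain ⟨x, rfl⟩ := hl
    rw [Finsupp.mapDomain_apply hφ, huv]
  · rw [Finsupp.mapDomain_of_notMem_range _ _ hl, hu l hl]

theorem coe_lowerClosure_image_mapDomain (S : Set (τ →₀ ℕ)) :
    (lowerClosure (Finsupp.mapDomain φ '' S) : Set (σ →₀ ℕ)) =
      Finsupp.mapDomain φ '' lowerClosure S := by
  ext u
  simp only [SetLike.mem_coe, mem_lowerClosure, Set.mem_image]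
  constructor
  · rintro ⟨_, ⟨v, hv, rfl⟩, huv⟩
    refine ⟨u.comapDomain φ hφ.injOn, ⟨v, hv, fun x => ?_⟩, ?_⟩
    · simpa [Finsupp.mapDomain_apply hφ] using huv (φ x)
    · refine mapDomain_eq_of_forall hφ (fun x => rfl) fun l hl => ?_
      simpa [Finsupp.mapDomain_of_notMem_range v l hl] using huv l
  · rintro ⟨w, ⟨v, hv, hwv⟩, rfl⟩
    refine ⟨_, ⟨v, hv, rfl⟩, fun l => ?_⟩
    by_cases hl : l ∈ Set.range φ
    · obtain ⟨x, rfl⟩ := hl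
      simpa only [Finsupp.mapDomain_apply hφ] using hwv x
    · simp [Finsupp.mapDomain_of_notMem_range _ l hl]

end MapDomain

/-! ### The standard monomials of the ideals of the classification -/

/-- The exponent `(b_1 - 1, …, b_n - 1)` of the monomial that spans the socle modulo
`(x_1^{b_1}, …, x_n^{b_n})`. -/
noncomputable def socleExponent {σ : Type*} [Finite σ] (b : σ → ℕ+) : σ →₀ ℕ :=
  Finsupp.equivFunOnFinite.symm fun l => (b l).natPred

section Ideals

variable {k : Type u} [Field k] {n : ℕ}

theorem le_socleExponent_iff {σ : Type*} [Finite σ] {b : σ → ℕ+} {u : σ →₀ ℕ} :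
    u ≤ socleExponent b ↔ ∀ l, u l < b l := by
  simp only [← PNat.natPred_add_one, Nat.lt_succ_iff]
  rfl

theorem mem_span_monomial_iff {σ : Type*} {S : Set (σ →₀ ℕ)} {p : MvPolynomial σ k} :
    p ∈ Ideal.span ((fun s => monomial s (1 : k)) '' S) ↔
      ∀ u, (∀ s ∈ S, ¬ s ≤ u) → coeff u p = 0 := by
  rw [mem_ideal_span_monomial_image]
  refine forall_congr' fun u => ?_
  rw [mem_support_iff, ne_eq, not_imp_comm]
  push Not
  rfl

theorem powerIdeal_eq_span_monomial (b : Fin n → ℕ+) :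
    powerIdeal k b = Ideal.span ((fun s => monomial s (1 : k)) ''
      Set.range fun l => Finsupp.single l (b l : ℕ)) := by
  simp only [powerIdeal, X_pow_eq_monomial, ← Set.range_comp, Function.comp_def]

theorem mem_powerIdeal_iff {b : Fin n → ℕ+} {p : MvPolynomial (Fin n) k} :
    p ∈ powerIdeal k b ↔ ∀ u ≤ socleExponent b, coeff u p = 0 := by
  simp only [powerIdeal_eq_span_monomial, mem_span_monomial_iff, Set.forall_mem_range,
    Finsupp.single_le_iff, not_le, le_socleExponent_iff]

theorem mem_tripleIdeal_iff {a : Fin 3 → Fin n → ℕ+} {p : MvPolynomial (Fin n) k} :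
    p ∈ tripleIdeal k a ↔
      ∀ u ∈ lowerClosure {socleExponent (a 0), socleExponent (a 1), socleExponent (a 2)},
        coeff u p = 0 := by
  simp only [tripleIdeal, Ideal.mem_inf, mem_powerIdeal_iff, mem_lowerClosure,
    Set.mem_insert_iff, Set.mem_singleton_iff, exists_eq_or_imp, exists_eq_left, or_imp,
    forall_and, and_assoc]

theorem mem_teterIdeal_iff {a : Fin n → ℕ+} {p : MvPolynomial (Fin n) k} :
    p ∈ powerIdeal k a ⊔ Ideal.span {∏ i, X i ^ ((a i : ℕ) - 1)} ↔
      ∀ u ∈ LowerSet.Iio (socleExponent a), coeff u p = 0 := by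
  have hprod : (∏ i, X i ^ ((a i : ℕ) - 1) : MvPolynomial (Fin n) k) =
      monomial (socleExponent a) 1 := by
    rw [monomial_eq, Finsupp.prod_fintype _ _ (by simp), C_1, one_mul]
    rfl
  rw [powerIdeal_eq_span_monomial, hprod, ← Ideal.span_union,
    ← Set.image_singleton (f := fun s => monomial s (1 : k)), ← Set.image_union]
  rw [mem_span_monomial_iff]
  refine forall_congr' fun u => imp_congr_left ?_
  rw [Set.union_singleton, Set.forall_mem_insert, Set.forall_mem_range, and_comm,
    LowerSet.mem_Iio_iff, lt_iff_le_not_ge, le_socleExponent_iff]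
  simp only [Finsupp.single_le_iff, not_le]

theorem isMonomialQuotient_mk {σ : Type*} {I : Ideal (MvPolynomial σ k)}
    {U : LowerSet (σ →₀ ℕ)} (hI : ∀ p, p ∈ I ↔ ∀ u ∈ U, coeff u p = 0)
    (hU : BddAbove (U : Set (σ →₀ ℕ))) : IsMonomialQuotient (Ideal.Quotient.mkₐ k I) U where
  surjective := Ideal.Quotient.mkₐ_surjective k I
  eq_zero_iff p := by rw [Ideal.Quotient.mkₐ_eq_mk, Ideal.Quotient.eq_zero_iff_mem, hI]
  bddAbove := hU

theorem isMonomialQuotient_tripleIdeal (a : Fin 3 → Fin n → ℕ+) :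
    IsMonomialQuotient (Ideal.Quotient.mkₐ k (tripleIdeal k a))
      (lowerClosure {socleExponent (a 0), socleExponent (a 1), socleExponent (a 2)}) :=
  isMonomialQuotient_mk (fun _ => mem_tripleIdeal_iff)
    (bddAbove_lowerClosure.mpr (Set.toFinite _).bddAbove)

theorem isMonomialQuotient_teterIdeal (a : Fin n → ℕ+) :
    IsMonomialQuotient
      (Ideal.Quotient.mkₐ k (powerIdeal k a ⊔ Ideal.span {∏ i, X i ^ ((a i : ℕ) - 1)}))
      (LowerSet.Iio (socleExponent a)) :=
  isMonomialQuotient_mk (fun _ => mem_teterIdeal_iff) bddAbove_Iio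

variable {R σ : Type*} [CommRing R] [Algebra k R] {π : MvPolynomial σ k →ₐ[k] R}
  {A B C : σ →₀ ℕ}

theorem IsMonomialQuotient.nonempty_algEquiv_tripleIdeal
    (h : IsMonomialQuotient π (lowerClosure {A, B, C})) {φ : Fin n → σ}
    (hφ : Function.Injective φ) (hrange : ∀ l ∉ Set.range φ, A l = 0 ∧ B l = 0 ∧ C l = 0)
    {a : Fin 3 → Fin n → ℕ+} (hA : ∀ x, (a 0 x : ℕ) = A (φ x) + 1)
    (hB : ∀ x, (a 1 x : ℕ) = B (φ x) + 1) (hC : ∀ x, (a 2 x : ℕ) = C (φ x) + 1) :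
    Nonempty (R ≃ₐ[k] MvPolynomial (Fin n) k ⧸ tripleIdeal k a) := by
  have mapDomain_socleExponent {b : Fin n → ℕ+} {D : σ →₀ ℕ} (hb : ∀ x, (b x : ℕ) = D (φ x) + 1)
      (hD : ∀ l ∉ Set.range φ, D l = 0) : Finsupp.mapDomain φ (socleExponent b) = D :=
    mapDomain_eq_of_forall hφ
      (fun x => Nat.succ_injective ((hb x).symm.trans (PNat.natPred_add_one _).symm)) hD
  refine (h.comp_rename hφ ?_).nonempty_algEquiv (isMonomialQuotient_tripleIdeal a)
  rw [← coe_lowerClosure_image_mapDomain hφ, Set.image_insert_eq, Set.image_pair,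
    mapDomain_socleExponent hA fun l hl => (hrange l hl).1,
    mapDomain_socleExponent hB fun l hl => (hrange l hl).2.1,
    mapDomain_socleExponent hC fun l hl => (hrange l hl).2.2]

end Ideals

/-! ### Lower sets with linear degrees -/

section Shapes

variable {σ : Type*}

/-- `x ^ B` exceeds `x ^ A` by one in the variable `x_l` and in no other variable. -/
def IsBump (l : σ) (A B : σ →₀ ℕ) : Prop :=
  B l = A l + 1 ∧ ∀ s ≠ l, B s ≤ A s

/-- The socle exponents `A`, `B`, `C` of the second family of the classification, whose first two
variables are `x_l` and `x_t`. -/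
structure CornerShape (l t : σ) (A B C : σ →₀ ℕ) : Prop where
  ne : l ≠ t
  left_bump : B l = A l + 1
  right_bump : C t = A t + 1
  left_eq_zero : ∀ s ≠ l, B s = 0
  right_eq_zero : ∀ s ≠ t, C s = 0
  exists_ne_zero : ∃ s, s ≠ l ∧ s ≠ t ∧ A s ≠ 0

/-- The socle exponents `A`, `B`, `C` of the third family of the classification, whose first two
variables are `x_l` and `x_t`. -/
structure SquareShape (l t : σ) (A B C : σ →₀ ℕ) : Prop where
  ne : l ≠ t
  left_bump : B l = A l + 1
  right_bump : A t = B t + 1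
  left_eq_zero : C l = 0
  right_eq_zero : C t = 0
  eq_zero : ∀ s, s ≠ l → s ≠ t → A s = 0 ∧ B s = 0

/-- The socle exponents `A`, `B`, `C` of the fourth family of the classification, whose first
variable is `x_l`. -/
structure HookShape (l : σ) (A B C : σ →₀ ℕ) : Prop where
  bump : B l = A l + 1
  eq_zero : C l = 0
  bump_eq_zero : ∀ s ≠ l, B s = 0
  eq_zero_or_eq_zero : ∀ s ≠ l, A s = 0 ∨ C s = 0

/-- The socle exponents `A`, `B`, `C` of the fifth family of the classification: no variable
divides two of the monomials. -/
def DisjointShape (A B C : σ →₀ ℕ) : Prop :=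
  ∀ l, A l = 0 ∧ B l = 0 ∨ A l = 0 ∧ C l = 0 ∨ B l = 0 ∧ C l = 0

theorem isLinearDegree_of_forall_le {S : Set (σ →₀ ℕ)} {A : σ →₀ ℕ} {l : σ}
    (hS : ∀ B ∈ S, B l ≠ 0 → B ≤ A) :
    IsLinearDegree (lowerClosure S) (A + Finsupp.single l 1) := by
  classical
  rintro t v w hvw hwt ⟨x, hx, hvx⟩ ⟨y, hy, hwy⟩
  have sum_eq : ∀ s, v s + w s = A s + Finsupp.single l 1 s + Finsupp.single t 1 s :=
    DFunLike.congr_fun hvw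
  have hxl : x l = 0 := by
    by_contra hxl
    have := sum_eq t
    have := hvx t
    have := hS x hx hxl t
    simp only [Finsupp.single_eq_same] at *
    omega
  have hwl : A l < w l := by
    have := sum_eq l
    have := hvx l
    simp only [Finsupp.single_eq_same] at *
    omega
  have := hwy l
  have := hS y hy (by omega) l
  omega

theorem isLinearDegree_of_isBump {S : Set (σ →₀ ℕ)} {A B : σ →₀ ℕ} {l : σ} (hB : IsBump l A B)
    (hS : ∀ C ∈ S, C = A ∨ C = B ∨ C l = 0 ∧ ∃ s, B s + C s < A s) :
    IsLinearDegree (lowerClosure S) (A + Finsupp.single l 1) := by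
  classical
  rintro t v w hvw hwt ⟨x, hx, hvx⟩ ⟨y, hy, hwy⟩
  have sum_eq : ∀ s, v s + w s = A s + Finsupp.single l 1 s + Finsupp.single t 1 s :=
    DFunLike.congr_fun hvw
  have hvt : A t + Finsupp.single l 1 t + 1 ≤ x t := by
    have := sum_eq t
    have := hvx t
    simp only [Finsupp.single_eq_same] at *
    omega
  obtain ⟨hxl, s, hs⟩ : x l = 0 ∧ ∃ s, B s + x s < A s := by
    rcases hS x hx with rfl | rfl | hx
    · omega
    · rcases eq_or_ne t l with rfl | htl
      · simp [hB.1] at hvt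
      · have := hB.2 t htl
        omega
    · exact hx
  have hwl : A l < y l := by
    have := sum_eq l
    have := hvx l
    have := hwy l
    simp only [Finsupp.single_eq_same] at *
    omega
  obtain rfl : y = B := by
    rcases hS y hy with rfl | rfl | hy
    · exact absurd hwl (lt_irrefl _)
    · rfl
    · omega
  have := sum_eq s
  have := hvx s
  have := hwy s
  omega

theorem hasLinearDegrees_lowerClosure {S : Set (σ →₀ ℕ)}
    (hS : ∀ l, ∃ A ∈ S, IsLinearDegree (lowerClosure S) (A + Finsupp.single l 1)) :
    HasLinearDegrees (lowerClosure S) := fun l _ =>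
  let ⟨A, hA, hd⟩ := hS l
  ⟨A, subset_lowerClosure hA, hd⟩

theorem hasLinearDegrees_Iio (d : σ →₀ ℕ) : HasLinearDegrees (LowerSet.Iio d) := by
  intro l hl
  have hd : d - Finsupp.single l 1 + Finsupp.single l 1 = d := tsub_add_cancel_of_le hl.le
  refine ⟨d - Finsupp.single l 1,
    LowerSet.mem_Iio_iff.mpr (lt_of_le_of_ne tsub_le_self fun h => ?_), ?_⟩
  · rw [h] at hd
    simpa using DFunLike.congr_fun hd l
  · rw [hd]
    intro t v w hvw hwt hv _
    have hvt := DFunLike.congr_fun hvw t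
    simp only [Finsupp.add_apply, hwt, Finsupp.single_eq_same] at hvt
    have := (LowerSet.mem_Iio_iff.mp hv).le t
    omega

variable {l t : σ} {A B C : σ →₀ ℕ}

theorem CornerShape.hasLinearDegrees (h : CornerShape l t A B C) :
    HasLinearDegrees (lowerClosure {A, B, C}) := by
  obtain ⟨s, hsl, hst, hs⟩ := h.exists_ne_zero
  have hBs := h.left_eq_zero s hsl
  have hCs := h.right_eq_zero s hst
  refine hasLinearDegrees_lowerClosure fun r => ⟨A, by simp, ?_⟩
  rcases eq_or_ne r l with rfl | hrl
  · refine isLinearDegree_of_isBump (B := B)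
      ⟨h.left_bump, fun x hx => by simp [h.left_eq_zero x hx]⟩ ?_
    rintro _ (rfl | rfl | rfl)
    exacts [.inl rfl, .inr (.inl rfl),
      .inr (.inr ⟨h.right_eq_zero r h.ne, s, by omega⟩)]
  rcases eq_or_ne r t with rfl | hrt
  · refine isLinearDegree_of_isBump (B := C)
      ⟨h.right_bump, fun x hx => by simp [h.right_eq_zero x hx]⟩ ?_
    rintro _ (rfl | rfl | rfl)
    exacts [.inl rfl, .inr (.inr ⟨h.left_eq_zero r hrl, s, by omega⟩), .inr (.inl rfl)]
  · refine isLinearDegree_of_forall_le ?_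
    rintro _ (rfl | rfl | rfl) hr
    exacts [le_rfl, absurd (h.left_eq_zero r hrl) hr, absurd (h.right_eq_zero r hrt) hr]

theorem SquareShape.hasLinearDegrees (h : SquareShape l t A B C) :
    HasLinearDegrees (lowerClosure {A, B, C}) := by
  have hl := h.left_bump
  have ht := h.right_bump
  have hCl := h.left_eq_zero
  have hCt := h.right_eq_zero
  refine hasLinearDegrees_lowerClosure fun r => ?_
  rcases eq_or_ne r l with rfl | hrl
  · refine ⟨A, by simp, isLinearDegree_of_isBump (B := B) ⟨hl, fun s hs => ?_⟩ ?_⟩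
    · rcases eq_or_ne s t with rfl | hst
      · omega
      · simp [h.eq_zero s hs hst]
    · rintro _ (rfl | rfl | rfl)
      exacts [.inl rfl, .inr (.inl rfl), .inr (.inr ⟨hCl, t, by omega⟩)]
  rcases eq_or_ne r t with rfl | hrt
  · refine ⟨B, by simp, isLinearDegree_of_isBump (B := A) ⟨ht, fun s hs => ?_⟩ ?_⟩
    · rcases eq_or_ne s l with rfl | hsl
      · omega
      · simp [h.eq_zero s hsl hs]
    · rintro _ (rfl | rfl | rfl)
      exacts [.inr (.inl rfl), .inl rfl, .inr (.inr ⟨hCt, l, by omega⟩)]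
  · refine ⟨C, by simp, isLinearDegree_of_forall_le ?_⟩
    rintro _ (rfl | rfl | rfl) hr
    exacts [absurd (h.eq_zero r hrl hrt).1 hr, absurd (h.eq_zero r hrl hrt).2 hr, le_rfl]

theorem HookShape.hasLinearDegrees (h : HookShape l A B C) :
    HasLinearDegrees (lowerClosure {A, B, C}) := by
  refine hasLinearDegrees_lowerClosure fun r => ?_
  rcases eq_or_ne r l with rfl | hrl
  · by_cases hA : ∃ s ≠ r, A s ≠ 0
    · obtain ⟨s, hsr, hs⟩ := hA
      have hBs := h.bump_eq_zero s hsr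
      have hCs := (h.eq_zero_or_eq_zero s hsr).resolve_left hs
      refine ⟨A, by simp, isLinearDegree_of_isBump (B := B)
        ⟨h.bump, fun x hx => by simp [h.bump_eq_zero x hx]⟩ ?_⟩
      rintro _ (rfl | rfl | rfl)
      exacts [.inl rfl, .inr (.inl rfl), .inr (.inr ⟨h.eq_zero, s, by omega⟩)]
    · push Not at hA
      refine ⟨B, by simp, isLinearDegree_of_forall_le ?_⟩
      rintro _ (rfl | rfl | rfl) hr
      · intro s
        rcases eq_or_ne s r with rfl | hsr
        · exact h.bump.symm ▸ Nat.le_succ _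
        · simp [hA s hsr]
      · exact le_rfl
      · exact absurd h.eq_zero hr
  have hBr := h.bump_eq_zero r hrl
  rcases h.eq_zero_or_eq_zero r hrl with hAr | hCr
  · refine ⟨C, by simp, isLinearDegree_of_forall_le ?_⟩
    rintro _ (rfl | rfl | rfl) hr
    exacts [absurd hAr hr, absurd hBr hr, le_rfl]
  · refine ⟨A, by simp, isLinearDegree_of_forall_le ?_⟩
    rintro _ (rfl | rfl | rfl) hr
    exacts [le_rfl, absurd hBr hr, absurd hCr hr]

theorem DisjointShape.hasLinearDegrees (h : DisjointShape A B C) :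
    HasLinearDegrees (lowerClosure {A, B, C}) := by
  refine hasLinearDegrees_lowerClosure fun l => ?_
  rcases h l with ⟨hA, hB⟩ | ⟨hA, hC⟩ | ⟨hB, hC⟩
  · refine ⟨C, by simp, isLinearDegree_of_forall_le ?_⟩
    rintro _ (rfl | rfl | rfl) hl
    exacts [absurd hA hl, absurd hB hl, le_rfl]
  · refine ⟨B, by simp, isLinearDegree_of_forall_le ?_⟩
    rintro _ (rfl | rfl | rfl) hl
    exacts [absurd hA hl, le_rfl, absurd hC hl]
  · refine ⟨A, by simp, isLinearDegree_of_forall_le ?_⟩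
    rintro _ (rfl | rfl | rfl) hl
    exacts [le_rfl, absurd hB hl, absurd hC hl]

end Shapes

section Listed

variable {k : Type u} [Field k] {n : ℕ}

theorem socleExponent_apply {σ : Type*} [Finite σ] (b : σ → ℕ+) (l : σ) :
    socleExponent b l = (b l : ℕ) - 1 := rfl

theorem IsListed.exists_hasLinearDegrees {I : Ideal (MvPolynomial (Fin n) k)} (hI : IsListed I) :
    ∃ U, IsMonomialQuotient (Ideal.Quotient.mkₐ k I) U ∧ HasLinearDegrees U := by
  have sub_add_one (a : ℕ+) : (a : ℕ) - 1 + 1 = a := Nat.sub_add_cancel a.pos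
  rcases hI with ⟨a, rfl⟩ | ⟨a, b, c, hn, hc, rfl⟩ | ⟨a, b, c, hn, rfl⟩ |
    ⟨s, a, b, c, hs, hsn, rfl⟩ | ⟨s, t, a, b, c, hst, -, rfl⟩
  · exact ⟨_, isMonomialQuotient_teterIdeal a, hasLinearDegrees_Iio _⟩
  · let r : Fin n := ⟨2, by omega⟩
    have hcr : (c r : ℕ) - 1 ≠ 0 := Nat.sub_ne_zero_of_lt (hc r le_rfl)
    refine ⟨_, isMonomialQuotient_tripleIdeal _,
      CornerShape.hasLinearDegrees (l := ⟨0, by omega⟩) (t := ⟨1, by omega⟩)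
        ⟨?_, ?_, ?_, fun i hi => ?_, fun i hi => ?_, r, ?_, ?_, ?_⟩⟩
    all_goals simp_all [socleExponent_apply, Fin.ext_iff, r]
  · refine ⟨_, isMonomialQuotient_tripleIdeal _,
      SquareShape.hasLinearDegrees (l := ⟨0, by omega⟩) (t := ⟨1, by omega⟩)
        ⟨?_, ?_, ?_, ?_, ?_, fun i hi hi' => ?_⟩⟩
    all_goals simp_all [socleExponent_apply, Fin.ext_iff]
  · refine ⟨_, isMonomialQuotient_tripleIdeal _,
      HookShape.hasLinearDegrees (l := ⟨0, by omega⟩)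
        ⟨?_, ?_, fun i hi => ?_, fun i hi => ?_⟩⟩
    · simp [socleExponent_apply, sub_add_one]
    · simp [socleExponent_apply]
    · simp_all [socleExponent_apply, Fin.ext_iff]
    · have hi0 : (i : ℕ) ≠ 0 := fun h => hi (Fin.ext h)
      by_cases his : (i : ℕ) < s <;> simp [socleExponent_apply, hi0, his]
  · refine ⟨_, isMonomialQuotient_tripleIdeal _, DisjointShape.hasLinearDegrees fun i => ?_⟩
    by_cases his : (i : ℕ) < s
    · simp [socleExponent_apply, his, his.trans_le hst]
    · by_cases hit : (i : ℕ) < t <;> simp [socleExponent_apply, his, hit]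

end Listed

/-! ### From the colon condition to the classification -/

section Irredundant

variable {σ ι : Type*}

/-- No member of the family is redundant as a generator of the lower set, except for zeros. -/
def Irredundant (α : ι → σ →₀ ℕ) : Prop :=
  ∀ i j, i ≠ j → α i ≤ α j → α i = 0

theorem exists_irredundant [Finite ι] (α : ι → σ →₀ ℕ) :
    ∃ β : ι → σ →₀ ℕ, lowerClosure (Set.range β) =
      lowerClosure (Set.range α) ∧ Irredundant β := by
  classical
  obtain ⟨β, hβ⟩ := exists_minimal_of_wellFoundedLT
    (fun β => lowerClosure (Set.range β) = lowerClosure (Set.range α)) ⟨α, rfl⟩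
  refine ⟨β, hβ.prop, fun i j hij hle => ?_⟩
  have hupdate : Function.update β i 0 ≤ β := update_le_self_iff.mpr zero_le
  have hclosure : lowerClosure (Set.range (Function.update β i 0)) =
      lowerClosure (Set.range α) := by
    refine (le_antisymm ?_ ?_).trans hβ.prop
    · rw [lowerClosure_le]
      rintro _ ⟨x, rfl⟩
      exact ⟨β x, Set.mem_range_self x, hupdate x⟩
    · rw [lowerClosure_le]
      rintro _ ⟨x, rfl⟩
      rcases eq_or_ne x i with rfl | hxi
      · exact ⟨β j, ⟨j, Function.update_of_ne hij.symm _ _⟩, hle⟩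
      · exact ⟨β x, ⟨x, Function.update_of_ne hxi _ _⟩, le_rfl⟩
  have hzero := hβ.le_of_le hclosure hupdate i
  rw [Function.update_self] at hzero
  exact le_antisymm hzero zero_le

/-- In every variable some monomial `x ^ α_i` is such that all the others which involve that
variable are bumps of it. -/
def HasHubs (α : ι → σ →₀ ℕ) : Prop :=
  ∀ l, ∃ i, ∀ j ≠ i, α j l ≠ 0 → IsBump l (α i) (α j)

variable {α : ι → σ →₀ ℕ}

theorem Irredundant.isBump_of_le (hα : Irredundant α) {i j : ι} (hji : j ≠ i) {l : σ}
    (hj : α j l ≠ 0) (hle : α j ≤ α i + Finsupp.single l 1) : IsBump l (α i) (α j) := by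
  have hle_of_ne : ∀ s ≠ l, α j s ≤ α i s := fun s hs => by
    simpa [Finsupp.single_eq_of_ne hs] using hle s
  refine ⟨?_, hle_of_ne⟩
  have hlel : α j l ≤ α i l + 1 := by simpa using hle l
  by_contra hne
  have hj0 := hα j i hji fun s => by
    rcases eq_or_ne s l with rfl | hs
    · omega
    · exact hle_of_ne s hs
  exact hj (by simp [hj0])

theorem MonomialColonCondition.isBump (hcolon : MonomialColonCondition (lowerClosure (Set.range α)))
    (hα : Irredundant α) {i j : ι} {l : σ} (hi : α i l ≠ 0)
    (hi' : ∀ x ≠ i, ¬ α i ≤ α x + Finsupp.single l 1) (hji : j ≠ i) (hj : α j l ≠ 0) :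
    IsBump l (α i) (α j) := by
  have sub_add_single {x : ι} (hx : α x l ≠ 0) :
      α x - Finsupp.single l 1 + Finsupp.single l 1 = α x :=
    tsub_add_cancel_of_le (Finsupp.single_le_iff.mpr (Nat.one_le_iff_ne_zero.mpr hx))
  refine hα.isBump_of_le hji hj (tsub_le_iff_right.mp ?_)
  rw [← sub_add_single hi]
  refine hcolon _ _ _ ?_ ⟨α i, Set.mem_range_self i, (sub_add_single hi).le⟩
  rintro w ⟨_, ⟨x, rfl⟩, hwx⟩
  obtain rfl : x = i := by
    by_contra hxi
    exact hi' x hxi (tsub_le_iff_right.mp (le_add_self.trans hwx))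
  refine ⟨α j, Set.mem_range_self j, ?_⟩
  have hw : w ≤ Finsupp.single l 1 := by
    rw [← add_le_add_iff_right (α x - Finsupp.single l 1), add_comm (Finsupp.single l 1),
      sub_add_single hi]
    exact hwx
  calc w + (α j - Finsupp.single l 1) ≤ Finsupp.single l 1 + (α j - Finsupp.single l 1) := by
        gcongr
    _ = α j := by rw [add_comm, sub_add_single hj]

theorem MonomialColonCondition.hasHubs {α : Fin 3 → σ →₀ ℕ}
    (hcolon : MonomialColonCondition (lowerClosure (Set.range α))) (hα : Irredundant α) :
    HasHubs α := by
  intro l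
  by_cases hprivate : ∃ i, α i l ≠ 0 ∧ ∀ x ≠ i, ¬ α i ≤ α x + Finsupp.single l 1
  · obtain ⟨i, hi, hi'⟩ := hprivate
    exact ⟨i, fun j => hcolon.isBump hα hi hi'⟩
  push Not at hprivate
  have exists_isBump : ∀ j, α j l ≠ 0 → ∃ x ≠ j, IsBump l (α x) (α j) := fun j hj =>
    let ⟨x, hxj, hle⟩ := hprivate j hj
    ⟨x, hxj, hα.isBump_of_le hxj.symm hj hle⟩
  obtain ⟨q, hq⟩ := Finite.exists_max fun i => α i l
  rcases eq_or_ne (α q l) 0 with hql | hql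
  · exact ⟨q, fun j _ hj => absurd (Nat.le_zero.mp (hql ▸ hq j)) hj⟩
  obtain ⟨x, hxq, hx⟩ := exists_isBump q hql
  refine ⟨x, fun j hjx hj => ?_⟩
  rcases eq_or_ne j q with rfl | hjq
  · exact hx
  obtain ⟨y, hyj, hy⟩ := exists_isBump j hj
  have hyq : y ≠ q := by
    rintro rfl
    have := hy.1
    have := hq j
    omega
  obtain rfl : y = x := by omega
  exact hy

end Irredundant

section ListedShape

variable {σ : Type*}

theorem Iio_eq_lowerClosure {S : Set (σ →₀ ℕ)} {d : σ →₀ ℕ}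
    (hS : ∀ A ∈ S, ∃ l, A + Finsupp.single l 1 = d)
    (hd : ∀ l, d l ≠ 0 → ∃ A ∈ S, A + Finsupp.single l 1 = d) :
    LowerSet.Iio d = lowerClosure S := by
  classical
  refine le_antisymm (fun u hu => ?_) (lowerClosure_le.mpr fun A hA => ?_)
  · obtain ⟨hle, l, hl⟩ := Finsupp.lt_def.mp (LowerSet.mem_Iio_iff.mp hu)
    obtain ⟨A, hA, rfl⟩ := hd l (Nat.ne_zero_of_lt hl)
    refine ⟨A, hA, fun s => ?_⟩
    have hs := hle s
    rcases eq_or_ne s l with rfl | hsl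
    · simpa [Nat.lt_succ_iff] using hl
    · simpa [Finsupp.single_eq_of_ne hsl] using hs
  · obtain ⟨l, rfl⟩ := hS A hA
    exact LowerSet.mem_Iio_iff.mpr (lt_add_of_pos_right A (pos_iff_ne_zero.mpr (by simp)))

theorem IsBump.index_ne {ι : Type*} {α : ι → σ →₀ ℕ} {i j : ι} {l : σ}
    (h : IsBump l (α i) (α j)) : i ≠ j := by
  rintro rfl
  exact Nat.succ_ne_self _ h.1.symm

theorem IsBump.add_single_eq {l s : σ} {A B : σ →₀ ℕ} (hB : IsBump l A B) (hA : IsBump s B A) :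
    B + Finsupp.single s 1 = A + Finsupp.single l 1 := by
  classical
  have hls : l ≠ s := by
    rintro rfl
    have := hB.1
    have := hA.1
    omega
  ext r
  rcases eq_or_ne r l with rfl | hrl
  · simp [hB.1, hls]
  rcases eq_or_ne r s with rfl | hrs
  · simp [hA.1, hrl]
  · simpa [hrl, hrs] using le_antisymm (hB.2 r hrl) (hA.2 r hrs)

theorem HasHubs.exists_isBump {α : Fin 3 → σ →₀ ℕ} (hhubs : HasHubs α) (hα : Irredundant α)
    {i j q : Fin 3} {l : σ} (hjq : j ≠ q) (hj : IsBump l (α i) (α j))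
    (hq : IsBump l (α i) (α q)) : ∃ s, IsBump s (α j) (α i) ∧ IsBump s (α j) (α q) := by
  have hjl := hj.1
  have hql := hq.1
  have not_le {x y : Fin 3} (hxy : x ≠ y) (hx : α x l ≠ 0) : ¬ α x ≤ α y := fun h =>
    hx (by simp [hα x y hxy h])
  obtain ⟨s, hs⟩ : ∃ s, α j s < α q s := by
    have := not_le hjq.symm (by omega)
    rw [Finsupp.le_def] at this
    push Not at this
    exact this
  have hsl : s ≠ l := by
    rintro rfl
    omega
  have hqs := hq.2 s hsl
  obtain ⟨h, hh⟩ := hhubs s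
  have hhi : h ≠ i := by
    rintro rfl
    have := (hh q hq.index_ne.symm (by omega)).1
    omega
  have hhq : h ≠ q := by
    rintro rfl
    have hi := hh i hhi.symm (by omega)
    refine not_le hjq (by omega) fun r => ?_
    rcases eq_or_ne r l with rfl | hrl
    · omega
    rcases eq_or_ne r s with rfl | hrs
    · exact hs.le
    · exact (hj.2 r hrl).trans (hi.2 r hrs)
  obtain rfl : h = j := by
    have := hj.index_ne
    have := hq.index_ne
    omega
  exact ⟨s, hh i hhi.symm (by omega), hh q hhq.symm (by omega)⟩

theorem HasHubs.exists_lowerClosure_eq_Iio {α : Fin 3 → σ →₀ ℕ} (hhubs : HasHubs α)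
    (hα : Irredundant α) {i j q : Fin 3} {l : σ} (hjq : j ≠ q) (hj : IsBump l (α i) (α j))
    (hq : IsBump l (α i) (α q)) : ∃ d, LowerSet.Iio d = lowerClosure (Set.range α) := by
  obtain ⟨s, hsi, hsq⟩ := hhubs.exists_isBump hα hjq hj hq
  obtain ⟨t, hti, htj⟩ := hhubs.exists_isBump hα hjq.symm hq hj
  have hij := hj.index_ne
  have hiq := hq.index_ne
  have cases_fin (x : Fin 3) : x = i ∨ x = j ∨ x = q := by omega
  have hjd := hj.add_single_eq hsi
  have hqd := hq.add_single_eq hti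
  refine ⟨α i + Finsupp.single l 1, Iio_eq_lowerClosure ?_ fun r hr => ?_⟩
  · rintro _ ⟨x, rfl⟩
    rcases cases_fin x with rfl | rfl | rfl
    exacts [⟨l, rfl⟩, ⟨s, hjd⟩, ⟨t, hqd⟩]
  by_cases hrl : r = l
  · exact ⟨α i, Set.mem_range_self i, by rw [hrl]⟩
  by_cases hrs : r = s
  · exact ⟨α j, Set.mem_range_self j, by rw [hrs, hjd]⟩
  by_cases hrt : r = t
  · exact ⟨α q, Set.mem_range_self q, by rw [hrt, hqd]⟩
  have hir : α i r ≠ 0 := by simpa [Finsupp.single_eq_of_ne hrl] using hr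
  have hjr : α j r = α i r := le_antisymm (hj.2 r hrl) (hsi.2 r hrs)
  have hqr : α q r = α i r := le_antisymm (hq.2 r hrl) (hti.2 r hrt)
  obtain ⟨h, hh⟩ := hhubs r
  rcases cases_fin h with rfl | rfl | rfl
  · have := (hh j hij.symm (by omega)).1
    omega
  · have := (hh i hij (by omega)).1
    omega
  · have := (hh i hiq (by omega)).1
    omega

/-- The lower sets of standard exponents of the ideals of the classification. -/
inductive IsListedShape : LowerSet (σ →₀ ℕ) → Prop
  | teter (d : σ →₀ ℕ) : IsListedShape (LowerSet.Iio d)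
  | corner {l t : σ} {A B C : σ →₀ ℕ} (h : CornerShape l t A B C) :
      IsListedShape (lowerClosure {A, B, C})
  | square {l t : σ} {A B C : σ →₀ ℕ} (h : SquareShape l t A B C) :
      IsListedShape (lowerClosure {A, B, C})
  | hook {l : σ} {A B C : σ →₀ ℕ} (h : HookShape l A B C) :
      IsListedShape (lowerClosure {A, B, C})
  | disjoint {A B C : σ →₀ ℕ} (h : DisjointShape A B C) :
      IsListedShape (lowerClosure {A, B, C})

theorem MonomialColonCondition.exists_ne_zero {A B C : σ →₀ ℕ} {l t : σ}
    (hcolon : MonomialColonCondition (lowerClosure {A, B, C})) (hlt : l ≠ t)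
    (hB : IsBump l A B) (hC : IsBump t A C) (hAl : A l ≠ 0) (hAt : A t ≠ 0)
    (hB0 : ∀ s ≠ l, B s = 0) (hC0 : ∀ s ≠ t, C s = 0) : ∃ s, s ≠ l ∧ s ≠ t ∧ A s ≠ 0 := by
  classical
  by_contra! hA0
  have hBl := hB.1
  have hCt := hC.1
  have := hcolon (Finsupp.single l (A l)) (Finsupp.single t 1) l ?_ ⟨B, by simp, fun s => ?_⟩ t
  · simp [hlt.symm] at this
  · rintro w ⟨x, hx, hwx⟩
    have hwl := hwx l
    simp only [Finsupp.add_apply, Finsupp.single_eq_same] at hwl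
    rcases hx with rfl | rfl | rfl
    · refine ⟨C, by simp, fun s => ?_⟩
      rcases eq_or_ne s t with rfl | hst
      · simpa [hCt, hlt.symm] using hwx s
      rcases eq_or_ne s l with rfl | hsl
      · simp only [Finsupp.add_apply, Finsupp.single_eq_of_ne hst]
        omega
      · have hws : w s = 0 := by simpa [hsl, hA0 s hsl hst] using hwx s
        simp [hws, hst]
    · refine ⟨A, by simp, fun s => ?_⟩
      rcases eq_or_ne s t with rfl | hst
      · have hws := hwx s
        simp only [Finsupp.add_apply, Finsupp.single_eq_of_ne hlt.symm, hB0 s hlt.symm] at hws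
        simp only [Finsupp.add_apply, Finsupp.single_eq_same]
        omega
      rcases eq_or_ne s l with rfl | hsl
      · simp only [Finsupp.add_apply, Finsupp.single_eq_of_ne hst]
        omega
      · have hws := hwx s
        simp only [Finsupp.add_apply, hB0 s hsl] at hws
        simp only [Finsupp.add_apply, Finsupp.single_eq_of_ne hst]
        omega
    · have := hC0 l hlt
      omega
  · rcases eq_or_ne s l with rfl | hs
    · simp [hBl]
    · simp [hs]

theorem MonomialColonCondition.isListedShape_of_isBump {A B C : σ →₀ ℕ} {l : σ}
    (hcolon : MonomialColonCondition (lowerClosure {A, B, C}))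
    (hAB : ∀ l, A l ≠ 0 → B l ≠ 0 → IsBump l A B ∨ IsBump l B A)
    (hAC : ∀ l, A l ≠ 0 → C l ≠ 0 → IsBump l A C ∨ IsBump l C A)
    (hABC : ∀ l, A l ≠ 0 → B l ≠ 0 → C l = 0) (hAl : A l ≠ 0) (hB : IsBump l A B) :
    IsListedShape (lowerClosure {A, B, C}) := by
  have hBl := hB.1
  have hCl := hABC l hAl (by omega)
  by_cases hBt : ∃ t ≠ l, B t ≠ 0
  · obtain ⟨t, htl, hBt⟩ := hBt
    have hBA : ∀ s ≠ l, B s ≠ 0 → IsBump s B A := fun s hsl hBs => by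
      have := hB.2 s hsl
      refine (hAB s (by omega) hBs).resolve_left fun h => ?_
      have := h.1
      omega
    have hA := hBA t htl hBt
    have hAt := hA.1
    have hB0 : ∀ s, s ≠ l → s ≠ t → B s = 0 := fun s hsl hst => by
      by_contra hBs
      have := (hBA s hsl hBs).1
      have := hA.2 s hst
      omega
    exact .square ⟨htl.symm, hBl, hAt, hCl, hABC t (by omega) hBt, fun s hsl hst =>
      ⟨Nat.le_zero.mp (hB0 s hsl hst ▸ hA.2 s hst), hB0 s hsl hst⟩⟩
  push Not at hBt
  by_cases hAt : ∃ t ≠ l, A t ≠ 0 ∧ C t ≠ 0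
  · obtain ⟨t, htl, hAt, hCt⟩ := hAt
    have hAC' : ∀ s ≠ l, A s ≠ 0 → C s ≠ 0 → IsBump s A C := fun s hsl hAs hCs =>
      (hAC s hAs hCs).resolve_right fun h => by
        have := h.2 l hsl.symm
        omega
    have hC := hAC' t htl hAt hCt
    have hC0 : ∀ s ≠ t, C s = 0 := fun s hst => by
      by_contra hCs
      have := hC.2 s hst
      have := (hAC' s (by rintro rfl; exact hCs hCl) (by omega) hCs).1
      omega
    exact .corner ⟨htl.symm, hBl, hC.1, hBt, hC0,
      hcolon.exists_ne_zero htl.symm hB hC hAl hAt hBt hC0⟩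
  push Not at hAt
  exact .hook ⟨hBl, hCl, hBt, fun s hsl => or_iff_not_imp_left.mpr (hAt s hsl)⟩

theorem HasHubs.isBump_or_isBump {α : Fin 3 → σ →₀ ℕ} (hhubs : HasHubs α)
    (hα : ∀ l i j q, j ≠ q → IsBump l (α i) (α j) → ¬ IsBump l (α i) (α q)) {x y : Fin 3} {l : σ}
    (hxy : x ≠ y) (hx : α x l ≠ 0) (hy : α y l ≠ 0) :
    (IsBump l (α x) (α y) ∨ IsBump l (α y) (α x)) ∧ ∀ z, z ≠ x → z ≠ y → α z l = 0 := by
  obtain ⟨i, hi⟩ := hhubs l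
  have eq_of_ne {j q : Fin 3} (hji : j ≠ i) (hqi : q ≠ i) (hj : α j l ≠ 0) (hq : α q l ≠ 0) :
      j = q := by
    by_contra hjq
    exact hα l i j q hjq (hi j hji hj) (hi q hqi hq)
  rcases eq_or_ne x i with rfl | hxi
  · refine ⟨.inl (hi y hxy.symm hy), fun z hzx hzy => ?_⟩
    by_contra hz
    exact hzy (eq_of_ne hzx hxy.symm hz hy)
  · obtain rfl : y = i := by
      by_contra hyi
      exact hxy (eq_of_ne hxi hyi hx hy)
    refine ⟨.inr (hi x hxi hx), fun z hzx hzy => ?_⟩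
    by_contra hz
    exact hzx (eq_of_ne hzy hxi hz hx)

theorem range_fin_three {β : Type*} {i j q : Fin 3} (hij : i ≠ j) (hiq : i ≠ q) (hjq : j ≠ q)
    (f : Fin 3 → β) : Set.range f = {f i, f j, f q} := by
  have hcases (x : Fin 3) : x = i ∨ x = j ∨ x = q := by omega
  refine Set.Subset.antisymm (Set.range_subset_iff.mpr fun x => ?_) ?_
  · rcases hcases x with rfl | rfl | rfl <;> simp
  · rintro _ (rfl | rfl | rfl) <;> exact Set.mem_range_self _

theorem MonomialColonCondition.isListedShape {α : Fin 3 → σ →₀ ℕ}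
    (hcolon : MonomialColonCondition (lowerClosure (Set.range α))) :
    IsListedShape (lowerClosure (Set.range α)) := by
  obtain ⟨β, hβα, hβ⟩ := exists_irredundant α
  rw [← hβα] at hcolon ⊢
  have hhubs := hcolon.hasHubs hβ
  by_cases hdouble : ∃ l i j q, j ≠ q ∧ IsBump l (β i) (β j) ∧ IsBump l (β i) (β q)
  · obtain ⟨l, i, j, q, hjq, hj, hq⟩ := hdouble
    obtain ⟨d, hd⟩ := hhubs.exists_lowerClosure_eq_Iio hβ hjq hj hq
    exact hd ▸ .teter d
  push Not at hdouble
  have exists_ne_ne : ∀ i j : Fin 3, ∃ q, q ≠ i ∧ q ≠ j := by decide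
  have isListedShape_of_isBump {i j : Fin 3} {l : σ} (hi : β i l ≠ 0)
      (hj : IsBump l (β i) (β j)) : IsListedShape (lowerClosure (Set.range β)) := by
    have hij := hj.index_ne
    obtain ⟨q, hqi, hqj⟩ := exists_ne_ne i j
    rw [range_fin_three hij hqi.symm hqj.symm] at hcolon ⊢
    exact hcolon.isListedShape_of_isBump
      (fun l hil hjl => (hhubs.isBump_or_isBump hdouble hij hil hjl).1)
      (fun l hil hql => (hhubs.isBump_or_isBump hdouble hqi.symm hil hql).1)
      (fun l hil hjl => (hhubs.isBump_or_isBump hdouble hij hil hjl).2 q hqi hqj) hi hj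
  by_cases hdisjoint : ∃ l i j, i ≠ j ∧ β i l ≠ 0 ∧ β j l ≠ 0
  · obtain ⟨l, i, j, hij, hi, hj⟩ := hdisjoint
    rcases (hhubs.isBump_or_isBump hdouble hij hi hj).1 with h | h
    · exact isListedShape_of_isBump hi h
    · exact isListedShape_of_isBump hj h
  push Not at hdisjoint
  rw [range_fin_three (i := 0) (j := 1) (q := 2) (by decide) (by decide) (by decide)]
  refine .disjoint fun l => ?_
  have h01 := hdisjoint l 0 1 (by decide)
  have h02 := hdisjoint l 0 2 (by decide)
  have h12 := hdisjoint l 1 2 (by decide)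
  tauto

end ListedShape

/-! ### Ordering the variables -/

section Listing

open Finset

theorem exists_perm_val_lt_card_iff {m n : ℕ} {S : Fin m → Finset (Fin n)} (hS : Monotone S) :
    ∃ e : Equiv.Perm (Fin n), ∀ c, ∀ x : Fin n, x < #(S c) ↔ e x ∈ S c := by
  let key (y : Fin n) : ℕ := #{c | y ∉ S c}
  have key_le_iff (y : Fin n) (c : Fin m) : key y ≤ c ↔ y ∈ S c := by
    refine ⟨fun hle => ?_, fun hy => ?_⟩
    · by_contra hy
      have : Iic c ⊆ ({c | y ∉ S c} : Finset (Fin m)) := fun d hd => by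
        simpa using fun hyd => hy (hS (mem_Iic.mp hd) hyd)
      have := (card_le_card this).trans hle
      simp [Fin.card_Iic] at this
    · have : ({c | y ∉ S c} : Finset (Fin m)) ⊆ Iio c := fun d hd => by
        rw [mem_Iio]
        by_contra! hcd
        exact (mem_filter.mp hd).2 (hS hcd hy)
      simpa [Fin.card_Iio] using card_le_card this
  refine ⟨Tuple.sort key, fun c x => ?_⟩
  have hcard : #{x | key (Tuple.sort key x) ≤ c} = #(S c) :=
    card_equiv (Tuple.sort key) fun x => by simp [key_le_iff]
  rw [← hcard, ← key_le_iff]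
  exact Tuple.lt_card_le_iff_apply_le_of_monotone (Tuple.monotone_sort key)

/-- A `k`-algebra isomorphic to the quotient by one of the ideals of the classification. -/
def IsListedAlgebra (k : Type u) [Field k] (R : Type*) [CommRing R] [Algebra k R] : Prop :=
  ∃ (m : ℕ) (I' : Ideal (MvPolynomial (Fin m) k)), IsListed I' ∧
    Nonempty (R ≃ₐ[k] (MvPolynomial (Fin m) k ⧸ I'))

variable {k : Type u} [Field k] {R : Type*} [CommRing R] [Algebra k R] {n : ℕ}
  {π : MvPolynomial (Fin n) k →ₐ[k] R} {A B C : Fin n →₀ ℕ}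

theorem IsMonomialQuotient.isListedAlgebra_of_teter {d : Fin n →₀ ℕ}
    (h : IsMonomialQuotient π (LowerSet.Iio d)) : IsListedAlgebra k R :=
  ⟨n, _, .inl ⟨fun l => (d l).succPNat, rfl⟩,
    h.nonempty_algEquiv (isMonomialQuotient_teterIdeal _)⟩

theorem CornerShape.isListedAlgebra {l t : Fin n} (hABC : CornerShape l t A B C)
    (h : IsMonomialQuotient π (lowerClosure {A, B, C})) : IsListedAlgebra k R := by
  obtain ⟨hlt, hBl, hCt, hB, hC, r, hrl, hrt, hr⟩ := hABC
  let W : Finset (Fin n) := {y | y = l ∨ y = t ∨ A y ≠ 0}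
  obtain ⟨e, he⟩ := exists_perm_val_lt_card_iff (S := ![{l}, {l, t}, W])
    (by simp [monotone_vecCons, insert_subset_iff, W])
  have val_lt_one (x : Fin n) : (x : ℕ) < 1 ↔ e x = l := by simpa using he 0 x
  have val_lt_two (x : Fin n) : (x : ℕ) < 2 ↔ e x = l ∨ e x = t := by
    simpa [card_pair hlt] using he 1 x
  have mem_W (x : Fin n) : x < #W ↔ e x = l ∨ e x = t ∨ A (e x) ≠ 0 := by simpa [W] using he 2 x
  have three_le : 3 ≤ #W := by
    rw [← card_eq_three.mpr ⟨l, t, r, hlt, hrl.symm, hrt.symm, rfl⟩]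
    exact card_le_card (by simp [insert_subset_iff, W, hr])
  have hWn : #W ≤ n := card_finset_fin_le W
  have hrange : ∀ s ∉ Set.range (e ∘ Fin.castLE hWn), s ≠ l ∧ A s = 0 ∧ s ≠ t := fun s hs => by
    have : ¬ e.symm s < #W := fun h => hs ⟨⟨e.symm s, h⟩, e.apply_symm_apply s⟩
    rw [mem_W, e.apply_symm_apply] at this
    tauto
  refine ⟨#W, _, .inr <| .inl ⟨(A l).succPNat, (A t).succPNat,
    fun x => (A (e (Fin.castLE hWn x))).succPNat, three_le, fun x hx => ?_, rfl⟩,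
    h.nonempty_algEquiv_tripleIdeal (e.injective.comp (Fin.castLE_injective _))
      (fun s hs => have ⟨hsl, hAs, hst⟩ := hrange s hs; ⟨hAs, hB s hsl, hC s hst⟩)
      (fun x => ?_) (fun x => ?_) (fun x => ?_)⟩
  · have hA := (mem_W (Fin.castLE hWn x)).mp x.isLt
    rw [← or_assoc, ← val_lt_two] at hA
    exact PNat.coe_lt_coe _ _ |>.mp <| Nat.succ_lt_succ <| Nat.pos_of_ne_zero <|
      hA.resolve_left hx.not_gt
  all_goals
    have := val_lt_one (Fin.castLE hWn x)
    have := val_lt_two (Fin.castLE hWn x)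
    simp only [Matrix.cons_val, apply_ite PNat.val, PNat.add_coe, PNat.one_coe, Nat.succPNat_coe]
    grind

theorem SquareShape.isListedAlgebra {l t : Fin n} (hABC : SquareShape l t A B C)
    (h : IsMonomialQuotient π (lowerClosure {A, B, C})) : IsListedAlgebra k R := by
  obtain ⟨hlt, hBl, hAt, hCl, hCt, hAB⟩ := hABC
  obtain ⟨e, he⟩ := exists_perm_val_lt_card_iff (S := ![{l}, {l, t}])
    (by simp [monotone_vecCons])
  have val_lt_one (x : Fin n) : (x : ℕ) < 1 ↔ e x = l := by simpa using he 0 x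
  have val_lt_two (x : Fin n) : (x : ℕ) < 2 ↔ e x = l ∨ e x = t := by
    simpa [card_pair hlt] using he 1 x
  have two_le : 2 ≤ n := (card_pair hlt).symm.trans_le (card_finset_fin_le _)
  refine ⟨n, _, .inr <| .inr <| .inl ⟨(A l).succPNat, (B t).succPNat, fun x => (C (e x)).succPNat,
    two_le, rfl⟩,
    h.nonempty_algEquiv_tripleIdeal e.injective (fun s hs => (hs (e.surjective s)).elim)
      (fun x => ?_) (fun x => ?_) (fun x => ?_)⟩
  all_goals
    have := val_lt_one x
    have := val_lt_two x
    simp only [Matrix.cons_val, apply_ite PNat.val, PNat.add_coe, PNat.one_coe, Nat.succPNat_coe]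
    grind

theorem HookShape.isListedAlgebra {l : Fin n} (hABC : HookShape l A B C)
    (h : IsMonomialQuotient π (lowerClosure {A, B, C})) : IsListedAlgebra k R := by
  obtain ⟨hBl, hCl, hB, hAC⟩ := hABC
  let S : Finset (Fin n) := {y | y = l ∨ A y = 0}
  have hlS : {l} ⊆ S := by simp [S]
  obtain ⟨e, he⟩ := exists_perm_val_lt_card_iff (S := ![{l}, S])
    (by simpa [monotone_vecCons] using hlS)
  have val_lt_one (x : Fin n) : (x : ℕ) < 1 ↔ e x = l := by simpa using he 0 x
  have mem_S (x : Fin n) : x < #S ↔ e x = l ∨ A (e x) = 0 := by simpa [S] using he 1 x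
  refine ⟨n, _, .inr <| .inr <| .inr <| .inl ⟨#S, (A l).succPNat, fun x => (A (e x)).succPNat,
    fun x => (C (e x)).succPNat, card_le_card hlS, card_finset_fin_le S, rfl⟩,
    h.nonempty_algEquiv_tripleIdeal e.injective (fun s hs => (hs (e.surjective s)).elim)
      (fun x => ?_) (fun x => ?_) (fun x => ?_)⟩
  all_goals
    have := val_lt_one x
    have := mem_S x
    simp only [Matrix.cons_val, apply_ite PNat.val, PNat.add_coe, PNat.one_coe, Nat.succPNat_coe]
    grind

theorem DisjointShape.isListedAlgebra (hABC : DisjointShape A B C)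
    (h : IsMonomialQuotient π (lowerClosure {A, B, C})) : IsListedAlgebra k R := by
  let S : Finset (Fin n) := {y | C y ≠ 0}
  let T : Finset (Fin n) := {y | C y ≠ 0 ∨ B y ≠ 0}
  have hST : S ⊆ T := monotone_filter_right _ fun _ _ => .inl
  obtain ⟨e, he⟩ := exists_perm_val_lt_card_iff (S := ![S, T])
    (by simpa [monotone_vecCons] using hST)
  have mem_S (x : Fin n) : x < #S ↔ C (e x) ≠ 0 := by simpa [S] using he 0 x
  have mem_T (x : Fin n) : x < #T ↔ C (e x) ≠ 0 ∨ B (e x) ≠ 0 := by simpa [T] using he 1 x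
  refine ⟨n, _, .inr <| .inr <| .inr <| .inr ⟨#S, #T, fun x => (C (e x)).succPNat,
    fun x => (B (e x)).succPNat, fun x => (A (e x)).succPNat, card_le_card hST,
    card_finset_fin_le T, rfl⟩,
    h.nonempty_algEquiv_tripleIdeal e.injective (fun s hs => (hs (e.surjective s)).elim)
      (fun x => ?_) (fun x => ?_) (fun x => ?_)⟩
  all_goals
    have := hABC (e x)
    have := mem_S x
    have := mem_T x
    simp only [Matrix.cons_val, apply_ite PNat.val, PNat.one_coe, Nat.succPNat_coe]
    grind

theorem IsMonomialQuotient.isListedAlgebra {U : LowerSet (Fin n →₀ ℕ)}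
    (h : IsMonomialQuotient π U) (hU : IsListedShape U) : IsListedAlgebra k R := by
  cases hU with
  | teter d => exact h.isListedAlgebra_of_teter
  | corner hABC => exact hABC.isListedAlgebra h
  | square hABC => exact hABC.isListedAlgebra h
  | hook hABC => exact hABC.isListedAlgebra h
  | disjoint hABC => exact hABC.isListedAlgebra h

end Listing

theorem Condition3.isListedAlgebra_tripleIdeal {k : Type u} [Field k] {n : ℕ}
    {a : Fin 3 → Fin n → ℕ+} {P : Set (PrimeSpectrum (MvPolynomial (Fin n) k ⧸ tripleIdeal k a))}
    (h3 : Condition3 P) (hP : ∀ p ∈ P, p.asIdeal ≠ maximalIdeal _) :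
    IsListedAlgebra k (MvPolynomial (Fin n) k ⧸ tripleIdeal k a) := by
  have h := isMonomialQuotient_tripleIdeal (k := k) a
  rw [← range_fin_three (i := 0) (j := 1) (q := 2) (by decide) (by decide) (by decide)
    fun i => socleExponent (a i)] at h
  have hcolon := h.monomialColonCondition fun _ _ _ => h3.mul_mem h.isNilpotent_maximalIdeal hP
  exact h.isListedAlgebra hcolon.isListedShape

end AlmostGorenstein

open AlmostGorenstein IsLocalRing

theorem theorem5p4_general {k : Type u} [Field k] {n : ℕ} (a : Fin 3 → Fin n → ℕ+) :
    (∃ (ω : Type u) (_ : AddCommGroup ω)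
        (_ : Module (MvPolynomial (Fin n) k ⧸ tripleIdeal k a) ω),
        IsCanonicalModule (MvPolynomial (Fin n) k ⧸ tripleIdeal k a) ω) ∧
    ∀ (ω : Type u) [AddCommGroup ω] [Module (MvPolynomial (Fin n) k ⧸ tripleIdeal k a) ω],
      IsCanonicalModule (MvPolynomial (Fin n) k ⧸ tripleIdeal k a) ω →
      ∀ P : Set (PrimeSpectrum (MvPolynomial (Fin n) k ⧸ tripleIdeal k a)),
        (∀ p ∈ P, p.asIdeal ≠ maximalIdeal _) →
        List.TFAE [
          Condition1 (MvPolynomial (Fin n) k ⧸ tripleIdeal k a) ω,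
          Condition2 (MvPolynomial (Fin n) k ⧸ tripleIdeal k a),
          Condition3 P,
          ∃ (m : ℕ) (I' : Ideal (MvPolynomial (Fin m) k)), IsListed I' ∧
            Nonempty ((MvPolynomial (Fin n) k ⧸ tripleIdeal k a) ≃ₐ[k]
              (MvPolynomial (Fin m) k ⧸ I')),
          ∃ (m : ℕ) (I' : Ideal (MvPolynomial (Fin m) k)), IsListed I' ∧
            Nonempty ((MvPolynomial (Fin n) k ⧸ tripleIdeal k a) ≃+*
              (MvPolynomial (Fin m) k ⧸ I'))] := by
  have h := isMonomialQuotient_tripleIdeal (k := k) a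
  refine ⟨⟨_, _, _, h.isCanonicalModule⟩, fun ω _ _ hω P hP => ?_⟩
  have := h.isNoetherianRing
  have := hω.injective
  tfae_have 1 → 2 := Condition1.condition2 h.isNilpotent_maximalIdeal
  tfae_have 2 → 3 := fun h2 => h2.condition3 P
  tfae_have 3 → 4 := fun h3 => h3.isListedAlgebra_tripleIdeal hP
  tfae_have 4 → 5 := fun ⟨m, I', hI', ⟨e⟩⟩ => ⟨m, I', hI', ⟨e.toRingEquiv⟩⟩
  tfae_have 5 → 1 := fun ⟨_, _, hI', ⟨e⟩⟩ =>
    have ⟨_, hU, hdeg⟩ := hI'.exists_hasLinearDegrees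
    hU.condition1_of_ringEquiv hdeg e hω
  tfae_finish

theorem theorem5p4 {k : Type u} [Field k] {n : ℕ} (a : Fin 3 → Fin n → ℕ+)
    (htype : AlmostGorenstein.cmType
      (MvPolynomial (Fin n) k ⧸ AlmostGorenstein.tripleIdeal k a) = 3) :
    (∃ (ω : Type u) (_ : AddCommGroup ω)
        (_ : Module (MvPolynomial (Fin n) k ⧸ AlmostGorenstein.tripleIdeal k a) ω),
        AlmostGorenstein.IsCanonicalModule
          (MvPolynomial (Fin n) k ⧸ AlmostGorenstein.tripleIdeal k a) ω) ∧
    ∀ (ω : Type u) [AddCommGroup ω]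
      [Module (MvPolynomial (Fin n) k ⧸ AlmostGorenstein.tripleIdeal k a) ω],
      AlmostGorenstein.IsCanonicalModule
        (MvPolynomial (Fin n) k ⧸ AlmostGorenstein.tripleIdeal k a) ω →
      ∀ P : Set (PrimeSpectrum (MvPolynomial (Fin n) k ⧸ AlmostGorenstein.tripleIdeal k a)),
        AlmostGorenstein.AdmissiblePrimes P →
        List.TFAE [
          AlmostGorenstein.Condition1
            (MvPolynomial (Fin n) k ⧸ AlmostGorenstein.tripleIdeal k a) ω,
          AlmostGorenstein.Condition2
            (MvPolynomial (Fin n) k ⧸ AlmostGorenstein.tripleIdeal k a),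
          AlmostGorenstein.Condition3 P,
          ∃ (m : ℕ) (I' : Ideal (MvPolynomial (Fin m) k)), AlmostGorenstein.IsListed I' ∧
            Nonempty ((MvPolynomial (Fin n) k ⧸ AlmostGorenstein.tripleIdeal k a) ≃ₐ[k]
              (MvPolynomial (Fin m) k ⧸ I')),
          ∃ (m : ℕ) (I' : Ideal (MvPolynomial (Fin m) k)), AlmostGorenstein.IsListed I' ∧
            Nonempty ((MvPolynomial (Fin n) k ⧸ AlmostGorenstein.tripleIdeal k a) ≃+*
              (MvPolynomial (Fin m) k ⧸ I'))] := by
  obtain ⟨hω, htfae⟩ := theorem5p4_general (k := k) a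
  exact ⟨hω, fun ω _ _ hω P hP => htfae ω hω P hP.2⟩
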